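/- **Conventions.** Graphs are directed. For graphs $G,H$: the Cartesian product $G\,\square\,H$ has vertex set $V(G)\times V(H)$ and edges $((v,u),(v',u'))$ with ($v=v'$ and $(u,u')\in E(H)$) or ($u=u'$ and $(v,v')\in E(G)$); the tensor product $G\times H$ has the same vertices and edges with $(v,v')\in E(G)$ and $(u,u')\in E(H)$; $G\cup H$ has vertex set $V(G)\cup V(H)$ and edge set $E(G)\cup E(H)$. Tuples are flattened. A *factored graph* is given by a formula built with these three binary operations from input graphs on vertex sets $\{0,\dots,m-1\}$; it has *complexity* $(n,k)$ if the formula has $k-1$ operations and all input graphs have at most $n$ vertices. Its vertices, which are tuples of integers, are ordered lexicographically. The LFMIS of an ordered graph is its lexicographically first maximal independent set (independent: no edge in either direction between two distinct members). A Turing machine $M$ is deterministic with a single tape, infinite to the right with cells $1,2,\dots$: states $Q$, tape alphabet $\Gamma\ni\perp$ (blank), input alphabet $\Sigma\subseteq\Gamma\setminus\{\perp\}$, transition function $\delta=(\delta_Q,\delta_\Gamma,\delta_d)$ into $Q\times\Gamma\times\{L,R\}$, start state $q_0$, and halting states $F=\{q_{\rm accept},q_{\rm reject}\}$, $q_{\rm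 accept}\ne q_{\rm reject}$. It stops on entering a halting state; a machine that moves left from cell $1$ stops without having halted. Time step $1$ is the initial configuration. $M$ is *normalized* if, whenever it halts, its head is on cell $1$ and this cell contains $\perp$. **The graph $G(M,x,T)$.** Let $x=(x_1,\dots,x_n)\in\Sigma^n$. Put $Q^*=Q\cup\{*\}$, $\dot Q=Q^*\cup\{\dot q_0\}$, $\dot\Gamma=\Gamma\cup\{\dot x_1,\dots,\dot x_n\}$ with $\dot x_1,\dots,\dot x_n$ new and distinct. The vertices are the tuples $(i,j,q,a)\in[T]\times[T]\times\dot Q\times\dot\Gamma$, ordered lexicographically, where $\dot q_0\prec *\prec q$ for $q\in Q$ and $\dot x_1\prec\dots\prec\dot x_n\prec\perp\prec a$ for $a\in\Gamma\setminus\{\perp\}$, with any order inside $Q$ and $\Gamma\setminus\{\perp\}$. The supernode $S_{i,j}$ is the set of the vertices with first coordinates $i,j$. For $(q,a)\in Q^*\times\Gamma$ let $$\mathcal C_V(q,a)=\begin{cases}\{(*,\delta_\Gamma(q,a))\}&q\in Q\setminus F\\ \{(q,a)\}&q\in F\\ Q^*\times\{a\}&q=*\end{cases}\qquad \mathcal C_R(q,a)=\begin{cases}\{\delta_Q(q,a)\}\times\Gamma&q\in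 Q\setminus F,\ \delta_d(q,a)=R\\ \{*\}\times\Gamma&q\in Q\setminus F,\ \delta_d(q,a)=L\\ Q^*\times\Gamma&q\in F\cup\{*\}\end{cases}$$ and let $\mathcal C_L$ be $\mathcal C_R$ with the roles of $L$ and $R$ in the conditions on $\delta_d$ exchanged; on special symbols, first replace $\dot q_0$ by $q_0$ and $\dot x_i$ by $x_i$. Let $\mathcal C_H(q,\dot x_i)=Q^*\times(\Gamma\cup\{\dot x_{i+1}\})$ for $1\le i<n$ and $\mathcal C_H(q,a)=Q^*\times\Gamma$ for all other $a\in\dot\Gamma$. The edges are: all pairs of distinct vertices of one supernode; and, for $D\in\{V,H,R,L\}$, the pairs $((i,j,q,a),(i',j',q',a'))$ with $(i',j')-(i,j)=(1,0),(0,1),(1,1),(1,-1)$ respectively and $(q',a')\notin\mathcal C_D(q,a)$. **The formula $F(M,x,b,k)$.** For $b\ge2$, $k\ge1$ and $T=b^k$, identify $[T]$ with $\{0,\dots,b-1\}^k$ through the base-$b$ expansion of $i-1$, most significant digit first. On $\{0,\dots,b-1\}$ let $A$ have no edges, $B$ the edges $(i,i+1)$, $C$ the single edge $(b-1,0)$.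 Let $\overline{K_T}=A^{\square k}$, let $\vec\pi_T=\bigcup_{i=0}^{k-1}A^{\square(k-i-1)}\,\square\,(B\times C^{\times i})$, and let $\overleftarrow\pi_T$ be the same with the edges of $B$ and $C$ reversed. Let $G_V=\vec\pi_T\,\square\,\overline{K_T}$, $G_H=\overline{K_T}\,\square\,\vec\pi_T$, $G_R=\vec\pi_T\times\vec\pi_T$, $G_L=\vec\pi_T\times\overleftarrow\pi_T$. Let $R_D$ be the graph on $\dot Q\times\dot\Gamma$ (numbered in lexicographic order) with an edge from $(q,a)$ to $(q',a')$ iff $(q',a')\notin\mathcal C_D(q,a)$, and $K$ the complete graph on $\dot Q\times\dot\Gamma$. Then $$F(M,x,b,k)=\big((\overline{K_T}\,\square\,\overline{K_T})\,\square\,K\big)\cup(G_V\times R_V)\cup(G_H\times R_H)\cup(G_R\times R_R)\cup(G_L\times R_L).$$ **Theorem.** 1. If $M$ is normalized, $n\ge1$, and $M$ halts on $x\in\Sigma^n$ at some time step $t\le T$, then $M$ accepts $x$ if and only if the vertex $(T,1,q_{\rm accept},\perp)$ belongs to the LFMIS of $G(M,x,T)$. 2. For all $M$, $x\in\Sigma^n$,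 $b\ge2$ and $k\ge1$, the factored graph $F(M,x,b,k)$ is $G(M,x,b^k)$, with the same edges and the same vertex order, and it has complexity $\big(\max\{b,(|Q|+2)(|\Gamma|+n)\},\,6k^2+4k+5\big)$. 3. Let $\ell\ge1$ and let $M$ be a normalized Turing machine that decides a language $L$ in time $O(n^\ell)$. There is a constant $C$ such that for every input $x$ of size $n\ge1$, with $b=\max\{n,2\}$, $M$ halts on $x$ at a time step $t\le C n^\ell$, and there is $k\ge1$ with $Cn^\ell\le b^k<b\cdot Cn^\ell$ such that the factored graph $G_x=F(M,x,b,k)$ has complexity $(O(n),O(\ell^2))$, and its vertex $u=(b^k,1,q_{\rm accept},\perp)$ belongs to the LFMIS of $G_x$ if and only if $M$ accepts $x$, that is, if and only if $x\in L$. The constant in $O(n)$ depends only on $M$. The bound $O(\ell^2)$ holds for all $n\ge1$ with a constant that does not depend on $x$, and with an absolute constant for all $n\ge N$, where $N$ does not depend on $x$. 4. Every language decided by a Turing machine in time $O(n^\ell)$, $\ell\ge1$, is decided in time $O(n^\ell)$ by a normalized Turing machine. -/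

import Mathlib

open Filter Asymptotics

namespace FactoredLFMIS

/-! ### Directed graphs, products, unions -/

/-- A directed graph whose vertices form a subset of an ambient type. -/
structure DGraph (V : Type) where
  verts : Set V
  Edge : V → V → Prop
  edge_mem : ∀ {u v : V}, Edge u v → u ∈ verts ∧ v ∈ verts

/-- Cartesian product of graphs on flattened tuples: the pair `(u, v)` is the concatenation
`u ++ v`. -/
def DGraph.cart (G H : DGraph (List ℕ)) : DGraph (List ℕ) where
  verts := {w | ∃ u ∈ G.verts, ∃ v ∈ H.verts, w = u ++ v}
  Edge w w' := ∃ u ∈ G.verts, ∃ v ∈ H.verts, ∃ u' ∈ G.verts, ∃ v' ∈ H.verts,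
    w = u ++ v ∧ w' = u' ++ v' ∧ ((u = u' ∧ H.Edge v v') ∨ (v = v' ∧ G.Edge u u'))
  edge_mem := by
    rintro w w' ⟨u, hu, v, hv, u', hu', v', hv', h, h', -⟩
    exact ⟨⟨u, hu, v, hv, h⟩, ⟨u', hu', v', hv', h'⟩⟩

/-- Tensor product of graphs on flattened tuples. -/
def DGraph.tensor (G H : DGraph (List ℕ)) : DGraph (List ℕ) where
  verts := {w | ∃ u ∈ G.verts, ∃ v ∈ H.verts, w = u ++ v}
  Edge w w' := ∃ u ∈ G.verts, ∃ v ∈ H.verts, ∃ u' ∈ G.verts, ∃ v' ∈ H.verts,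
    w = u ++ v ∧ w' = u' ++ v' ∧ G.Edge u u' ∧ H.Edge v v'
  edge_mem := by
    rintro w w' ⟨u, hu, v, hv, u', hu', v', hv', h, h', -⟩
    exact ⟨⟨u, hu, v, hv, h⟩, ⟨u', hu', v', hv', h'⟩⟩

/-- Union of graphs: union of the vertex sets and union of the edge sets. -/
def DGraph.union {V : Type} (G H : DGraph V) : DGraph V where
  verts := G.verts ∪ H.verts
  Edge u v := G.Edge u v ∨ H.Edge u v
  edge_mem := by
    rintro u v (h | h)
    · exact ⟨Or.inl (G.edge_mem h).1, Or.inl (G.edge_mem h).2⟩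
    · exact ⟨Or.inr (H.edge_mem h).1, Or.inr (H.edge_mem h).2⟩

/-- `φ` identifies `G`, ordered by `lt`, with `H`, ordered by `lt'`: it is a bijection between
the vertex sets that preserves and reflects the edges and the order. -/
def DGraph.IsOrderedIso {V W : Type} (G : DGraph V) (lt : V → V → Prop)
    (H : DGraph W) (lt' : W → W → Prop) (φ : V → W) : Prop :=
  Set.BijOn φ G.verts H.verts ∧
    ∀ u ∈ G.verts, ∀ v ∈ G.verts,
      (G.Edge u v ↔ H.Edge (φ u) (φ v)) ∧ (lt u v ↔ lt' (φ u) (φ v))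

/-! ### Lexicographically first maximal independent set -/

def DGraph.IsIndep {V : Type} (G : DGraph V) (I : Set V) : Prop :=
  I ⊆ G.verts ∧ ∀ u ∈ I, ∀ v ∈ I, u ≠ v → ¬ G.Edge u v

def DGraph.IsMaxIndep {V : Type} (G : DGraph V) (I : Set V) : Prop :=
  G.IsIndep I ∧ ∀ J : Set V, I ⊂ J → ¬ G.IsIndep J

/-- `I` is a maximal independent set that precedes every other maximal independent set `J`
lexicographically: the first vertex on which `I` and `J` differ belongs to `I`. -/
def DGraph.IsLFMIS {V : Type} (G : DGraph V) (lt : V → V → Prop) (I : Set V) : Prop :=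
  G.IsMaxIndep I ∧ ∀ J : Set V, G.IsMaxIndep J → J ≠ I →
    ∃ v ∈ I, v ∉ J ∧ ∀ w, lt w v → (w ∈ I ↔ w ∈ J)

/-- The lexicographically first maximal independent set of `G` for the vertex order `lt`. -/
def DGraph.lfmis {V : Type} (G : DGraph V) (lt : V → V → Prop) : Set V :=
  {v | ∃ I, G.IsLFMIS lt I ∧ v ∈ I}

/-! ### Factored graphs -/

/-- An input graph, on the vertices `0, …, size - 1`. -/
structure InputGraph where
  size : ℕ
  Edge : Fin size → Fin size → Prop

/-- An input graph as a graph on one-element tuples. -/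
def InputGraph.toDGraph (A : InputGraph) : DGraph (List ℕ) where
  verts := {w | ∃ i : Fin A.size, w = [(i : ℕ)]}
  Edge w w' := ∃ i j : Fin A.size, w = [(i : ℕ)] ∧ w' = [(j : ℕ)] ∧ A.Edge i j
  edge_mem := by
    rintro w w' ⟨i, j, h, h', -⟩
    exact ⟨⟨i, h⟩, ⟨j, h'⟩⟩

/-- Factored graph formulas: expressions over input graphs with three binary operations. -/
inductive Formula where
  | input (A : InputGraph) : Formula
  | cart (f g : Formula) : Formula
  | tensor (f g : Formula) : Formula
  | union (f g : Formula) : Formula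

/-- The factored graph of a formula; its vertices are flattened tuples, to be ordered
lexicographically. -/
def Formula.eval : Formula → DGraph (List ℕ)
  | .input A => A.toDGraph
  | .cart f g => f.eval.cart g.eval
  | .tensor f g => f.eval.tensor g.eval
  | .union f g => f.eval.union g.eval

/-- The number of operations in a formula. -/
def Formula.ops : Formula → ℕ
  | .input _ => 0
  | .cart f g => f.ops + g.ops + 1
  | .tensor f g => f.ops + g.ops + 1
  | .union f g => f.ops + g.ops + 1

/-- All the input graphs of a formula have at most `n` vertices. -/
def Formula.InputsLE (n : ℕ) : Formula → Prop
  | .input A => A.size ≤ n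
  | .cart f g => f.InputsLE n ∧ g.InputsLE n
  | .tensor f g => f.InputsLE n ∧ g.InputsLE n
  | .union f g => f.InputsLE n ∧ g.InputsLE n

/-- Complexity `(n, k)`: `k - 1` operations on input graphs of size at most `n`. -/
def Formula.HasComplexity (f : Formula) (n k : ℕ) : Prop :=
  f.InputsLE n ∧ f.ops + 1 = k

/-! ### Deterministic single-tape Turing machines -/

inductive Dir where
  | L : Dir
  | R : Dir

/-- A deterministic single-tape Turing machine with state set `Q`, tape alphabet `Γ` and input
alphabet `α`, which `inp` embeds into `Γ` without the blank symbol. The values of `δ` at the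
halting states are never used. -/
structure TM (α Q Γ : Type) where
  δ : Q → Γ → Q × Γ × Dir
  q₀ : Q
  qacc : Q
  qrej : Q
  qacc_ne_qrej : qacc ≠ qrej
  blank : Γ
  inp : α ↪ Γ
  inp_ne_blank : ∀ a, inp a ≠ blank

/-- A configuration. The tape is infinite to the right; its leftmost cell has number `0`. -/
structure Cfg (Q Γ : Type) where
  state : Q
  head : ℕ
  tape : ℕ → Γ

namespace TM

variable {α Q Γ : Type} (M : TM α Q Γ)

def Halting (q : Q) : Prop := q = M.qacc ∨ q = M.qrej

def init (x : List α) : Cfg Q Γ where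
  state := M.q₀
  head := 0
  tape i := (x[i]?).elim M.blank M.inp

open Classical in
/-- One step. There is no next configuration in a halting state, nor after a left move in the
leftmost cell: a machine that falls off its tape stops without having halted. -/
noncomputable def step (c : Cfg Q Γ) : Option (Cfg Q Γ) :=
  if M.Halting c.state then none
  else
    match M.δ c.state (c.tape c.head), c.head with
    | (q, a, Dir.R), h => some ⟨q, h + 1, Function.update c.tape h a⟩
    | (_, _, Dir.L), 0 => none
    | (q, a, Dir.L), h + 1 => some ⟨q, h, Function.update c.tape (h + 1) a⟩

/-- The configuration after `s` steps on input `x`, if the machine makes that many. -/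
noncomputable def run (x : List α) : ℕ → Option (Cfg Q Γ)
  | 0 => some (M.init x)
  | s + 1 => (run x s).bind M.step

/-- On input `x` the machine enters a halting state after exactly `s` steps. -/
def HaltsAfter (x : List α) (s : ℕ) : Prop :=
  ∃ c, M.run x s = some c ∧ M.Halting c.state

def Accepts (x : List α) : Prop :=
  ∃ s c, M.run x s = some c ∧ c.state = M.qacc

/-- Whenever the machine halts, the head is on the leftmost cell and that cell is blank. -/
def Normalized : Prop :=
  ∀ x s c, M.run x s = some c → M.Halting c.state → c.head = 0 ∧ c.tape 0 = M.blank

/-- `M` decides `L` in time `O(n ^ ℓ)`. -/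
def DecidesInTimePow (L : Language α) (ℓ : ℕ) : Prop :=
  (∀ x, x ∈ L ↔ M.Accepts x) ∧
    ∃ f : ℕ → ℕ, (∀ x : List α, ∃ s ≤ f x.length, M.HaltsAfter x s) ∧
      (fun n : ℕ => (f n : ℝ)) =O[atTop] (fun n : ℕ => (n : ℝ) ^ ℓ)

end TM

/-! ### The tiles: pairs of an extended state and an extended symbol -/

/-- `Q ∪ {*, q̇₀}`: `start` is the special start state `q̇₀`, and `star` is `*`, which says that
the head is elsewhere. -/
inductive XState (Q : Type) where
  | start : XState Q
  | star : XState Q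
  | st (q : Q) : XState Q

/-- `Γ ∪ {ẋ₁, …, ẋₙ}`: `special i` is the special input symbol `ẋᵢ₊₁`, with distinct symbols
for distinct positions. -/
inductive XSym (Γ : Type) (n : ℕ) where
  | special (i : Fin n) : XSym Γ n
  | sym (a : Γ) : XSym Γ n

abbrev Tile (Q Γ : Type) (n : ℕ) : Type := XState Q × XSym Γ n

/-- `Q ∪ {*}` inside `Q ∪ {*, q̇₀}`. -/
def plainStates (Q : Type) : Set (XState Q) := {p | p ≠ XState.start}

/-- `Γ` inside `Γ ∪ {ẋ₁, …, ẋₙ}`. -/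
def plainSyms (Γ : Type) (n : ℕ) : Set (XSym Γ n) := Set.range XSym.sym

/-- The four neighbouring directions of the grid. -/
inductive GDir where
  | V : GDir
  | H : GDir
  | R : GDir
  | L : GDir

namespace TM

variable {α Q Γ : Type} (M : TM α Q Γ) (x : List α)

/-- Replace `q̇₀` by `q₀`; `none` stands for `*`. -/
def unstar : XState Q → Option Q
  | .start => some M.q₀
  | .star => none
  | .st q => some q

/-- Replace `ẋᵢ` by `xᵢ`. -/
def undot : XSym Γ x.length → Γ
  | .special i => M.inp (x.get i)
  | .sym a => a

open Classical in
/-- Vertical consistency. -/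
noncomputable def consV (t : Tile Q Γ x.length) : Set (Tile Q Γ x.length) :=
  match M.unstar t.1 with
  | none => plainStates Q ×ˢ {XSym.sym (M.undot x t.2)}
  | some q =>
    if M.Halting q then {(XState.st q, XSym.sym (M.undot x t.2))}
    else {(XState.star, XSym.sym (M.δ q (M.undot x t.2)).2.1)}

/-- Horizontal consistency. -/
def consH (t : Tile Q Γ x.length) : Set (Tile Q Γ x.length) :=
  match t.2 with
  | .special i => plainStates Q ×ˢ
      (plainSyms Γ x.length ∪ {a | ∃ j : Fin x.length, (j : ℕ) = i + 1 ∧ a = XSym.special j})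
  | .sym _ => plainStates Q ×ˢ plainSyms Γ x.length

open Classical in
/-- Diagonal consistency towards the side `d`: if the head is on the tile and moves to the side
`d`, it carries the new state there; if it moves to the other side, no head arrives. -/
noncomputable def consDiag (d : Dir) (t : Tile Q Γ x.length) : Set (Tile Q Γ x.length) :=
  match M.unstar t.1 with
  | none => plainStates Q ×ˢ plainSyms Γ x.length
  | some q =>
    if M.Halting q then plainStates Q ×ˢ plainSyms Γ x.length
    else if (M.δ q (M.undot x t.2)).2.2 = d then
      {XState.st (M.δ q (M.undot x t.2)).1} ×ˢ plainSyms Γ x.length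
    else {XState.star} ×ˢ plainSyms Γ x.length

/-- `M.cons x D t` is the set of tiles that are consistent with `t` when placed next to `t` in
the direction `D`. -/
noncomputable def cons : GDir → Tile Q Γ x.length → Set (Tile Q Γ x.length)
  | .V => M.consV x
  | .H => consH x
  | .R => M.consDiag x Dir.R
  | .L => M.consDiag x Dir.L

end TM

/-! ### The grid of supernodes -/

/-- The vertex `(row, col, q, a)`, which lies in the supernode `S (row, col)`. -/
structure Node (Q Γ : Type) (n : ℕ) where
  row : ℕ
  col : ℕ
  tile : Tile Q Γ n

/-- The supernode `S (i, j)` is the parent of `S (i', j')` in the given direction. -/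
def IsParent : GDir → ℕ × ℕ → ℕ × ℕ → Prop
  | .V, (i, j), (i', j') => i' = i + 1 ∧ j' = j
  | .H, (i, j), (i', j') => i' = i ∧ j' = j + 1
  | .R, (i, j), (i', j') => i' = i + 1 ∧ j' = j + 1
  | .L, (i, j), (i', j') => i' = i + 1 ∧ j' + 1 = j

/-- The vertices of the `T × T` grid of supernodes; rows and columns run from `1` to `T`. -/
def gridVerts (Q Γ : Type) (n T : ℕ) : Set (Node Q Γ n) :=
  {v | 1 ≤ v.row ∧ v.row ≤ T ∧ 1 ≤ v.col ∧ v.col ≤ T}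

/-- The graph that simulates `M` on `x` for `T` time steps: every supernode is a complete graph,
and there is an edge from a vertex of a parent supernode to a vertex of its child in the
direction `D` exactly if their tiles are not consistent. -/
def TM.gridGraph {α Q Γ : Type} (M : TM α Q Γ) (x : List α) (T : ℕ) :
    DGraph (Node Q Γ x.length) where
  verts := gridVerts Q Γ x.length T
  Edge u v := u ∈ gridVerts Q Γ x.length T ∧ v ∈ gridVerts Q Γ x.length T ∧
    ((u.row = v.row ∧ u.col = v.col ∧ u ≠ v) ∨
      ∃ D : GDir, IsParent D (u.row, u.col) (v.row, v.col) ∧ v.tile ∉ M.cons x D u.tile)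
  edge_mem := fun h => ⟨h.1, h.2.1⟩

/-- The vertex `(T, 1, q_accept, blank)`. -/
def TM.acceptNode {α Q Γ : Type} (M : TM α Q Γ) (n T : ℕ) : Node Q Γ n :=
  ⟨T, 1, (XState.st M.qacc, XSym.sym M.blank)⟩

/-- An enumeration of the states, and one of the tape symbols that starts with the blank. -/
structure TM.Numbering {α Q Γ : Type} [Fintype Q] [Fintype Γ] (M : TM α Q Γ) where
  stateIdx : Q ≃ Fin (Fintype.card Q)
  symIdx : Γ ≃ Fin (Fintype.card Γ)
  symIdx_blank : (symIdx M.blank : ℕ) = 0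

namespace TM.Numbering

variable {α Q Γ : Type} [Fintype Q] [Fintype Γ] {M : TM α Q Γ} (ν : M.Numbering)

/-- The index of an extended state: first `q̇₀`, then `*`, then `Q`. -/
def xstateIdx : XState Q → ℕ
  | .start => 0
  | .star => 1
  | .st q => ν.stateIdx q + 2

/-- The index of an extended symbol: first `ẋ₁, …, ẋₙ`, then the blank, then the rest. -/
def xsymIdx {n : ℕ} : XSym Γ n → ℕ
  | .special i => i
  | .sym a => n + ν.symIdx a

/-- The number of tiles. -/
def tileCount (_ : M.Numbering) (n : ℕ) : ℕ := (Fintype.card Q + 2) * (Fintype.card Γ + n)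

/-- The index of a tile in the lexicographic order on pairs. -/
def tileIdx {n : ℕ} (t : Tile Q Γ n) : ℕ :=
  ν.xstateIdx t.1 * (Fintype.card Γ + n) + ν.xsymIdx t.2

/-- The lexicographic order on the vertices `(i, j, q, a)` of the grid. -/
def prec {n : ℕ} (u v : Node Q Γ n) : Prop :=
  toLex (u.row, toLex (u.col, toLex (ν.xstateIdx u.tile.1, ν.xsymIdx u.tile.2))) <
    toLex (v.row, toLex (v.col, toLex (ν.xstateIdx v.tile.1, ν.xsymIdx v.tile.2)))

end TM.Numbering

/-! ### The factored representation of the grid -/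

/-- The `k` base-`b` digits of `m`, the most significant digit first. -/
def digits (b k m : ℕ) : List ℕ := (List.range k).reverse.map fun i => m / b ^ i % b

/-- The empty graph on `b` vertices. -/
def emptyInput (b : ℕ) : InputGraph := ⟨b, fun _ _ => False⟩

/-- The complete graph on `b` vertices. -/
def completeInput (b : ℕ) : InputGraph := ⟨b, fun i j => i ≠ j⟩

/-- The edges `i → i + 1`. -/
def succInput (b : ℕ) : InputGraph := ⟨b, fun i j => (j : ℕ) = i + 1⟩

/-- The single edge `b - 1 → 0`. -/
def wrapInput (b : ℕ) : InputGraph := ⟨b, fun i j => (i : ℕ) + 1 = b ∧ (j : ℕ) = 0⟩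

def InputGraph.reverse (A : InputGraph) : InputGraph := ⟨A.size, fun i j => A.Edge j i⟩

namespace Formula

/-- `A □ ⋯ □ A □ f`, with `m` factors `A`. -/
def cartPrefix (A : InputGraph) : ℕ → Formula → Formula
  | 0, f => f
  | m + 1, f => .cart (.input A) (cartPrefix A m f)

/-- `f × C × ⋯ × C`, with `m` factors `C`. -/
def tensorSuffix (C : InputGraph) : ℕ → Formula → Formula
  | 0, f => f
  | m + 1, f => .tensor (tensorSuffix C m f) (.input C)

/-- `f 0 ∪ ⋯ ∪ f m`. -/
def unionUpTo (f : ℕ → Formula) : ℕ → Formula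
  | 0 => f 0
  | m + 1 => .union (unionUpTo f m) (f (m + 1))

/-- The empty graph on `b ^ k` vertices, as a Cartesian power (for `k ≥ 1`). -/
def emptyPow (b k : ℕ) : Formula :=
  cartPrefix (emptyInput b) (k - 1) (.input (emptyInput b))

/-- The union over `i < k` of `A □ ⋯ □ A □ (B × C × ⋯ × C)`, with `k - i - 1` factors `A` and
`i` factors `C`, where `A` is the empty graph on `b` vertices (for `k ≥ 1`). -/
def pathOf (b k : ℕ) (B C : InputGraph) : Formula :=
  unionUpTo (fun i => cartPrefix (emptyInput b) (k - i - 1) (tensorSuffix C i (.input B))) (k - 1)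

/-- The increasing path on the `b ^ k` numbers with `k` digits in base `b`. -/
def incPath (b k : ℕ) : Formula := pathOf b k (succInput b) (wrapInput b)

/-- The decreasing path on the `b ^ k` numbers with `k` digits in base `b`. -/
def decPath (b k : ℕ) : Formula := pathOf b k (succInput b).reverse (wrapInput b).reverse

/-- The grid of `b ^ k × b ^ k` points with an edge from each point to its neighbour in the given
direction. -/
def grid (b k : ℕ) : GDir → Formula
  | .V => .cart (incPath b k) (emptyPow b k)
  | .H => .cart (emptyPow b k) (incPath b k)
  | .R => .tensor (incPath b k) (incPath b k)
  | .L => .tensor (incPath b k) (decPath b k)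

end Formula

namespace TM.Numbering

variable {α Q Γ : Type} [Fintype Q] [Fintype Γ] {M : TM α Q Γ} (ν : M.Numbering) (x : List α)

/-- The consistency relation graph: an edge from `t` to `t'` if `t'` is not consistent with `t`
in the direction `D`. -/
def relInput (D : GDir) : InputGraph where
  size := ν.tileCount x.length
  Edge i j := ∃ t t' : Tile Q Γ x.length,
    ν.tileIdx t = i ∧ ν.tileIdx t' = j ∧ t' ∉ M.cons x D t

/-- The grid in the direction `D`, with every point blown up to a supernode. -/
def superGrid (b k : ℕ) (D : GDir) : Formula :=
  .tensor (.grid b k D) (.input (ν.relInput x D))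

/-- The factored representation of the graph that simulates `M` on `x` for `b ^ k` time steps. -/
def factored (b k : ℕ) : Formula :=
  .union
    (.cart (.cart (.emptyPow b k) (.emptyPow b k)) (.input (completeInput (ν.tileCount x.length))))
    (.union (.union (.union (ν.superGrid x b k .V) (ν.superGrid x b k .H))
      (ν.superGrid x b k .R)) (ν.superGrid x b k .L))

/-- The vertex `(i, j, q, a)` as a flattened tuple: the digits of `i - 1`, the digits of `j - 1`
and the index of the tile `(q, a)`. -/
def code {n : ℕ} (b k : ℕ) (v : Node Q Γ n) : List ℕ :=
  digits b k (v.row - 1) ++ digits b k (v.col - 1) ++ [ν.tileIdx v.tile]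

end TM.Numbering

end FactoredLFMIS

/-!
The LFMIS is the outcome of the greedy algorithm. Since every supernode is a clique, at most one
vertex is chosen in it: its first vertex that is consistent with the choices in the parent
supernodes. In the first row this yields `q̇₀` in the first column, `*` elsewhere, and the special
symbols followed by blanks, that is, the initial configuration. In a later row, the vertical edges
copy the symbol, or replace it where the head was, and the diagonal edges bring the head; where none
arrives, `*` is chosen because it precedes all states. So row `i` is the configuration at time `i`,
and as consistency with a halting configuration repeats it, row `T` shows the final one.

For the factored form, `i → i + 1` in base `b` increments the last digit other than `b - 1` and
resets the digits `b - 1` behind it to `0`; the summand with `i` factors `C` is the case of `i`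
resets. The LFMIS carries over to it because an ordered isomorphism preserves the LFMIS.

A machine is normalized by marking the leftmost cell in the first step, so that the simulation can
return to it at the end: after `s` steps the head is at most at cell `s`, hence the running time
at most doubles up to a constant.
-/

namespace FactoredLFMIS

/-! ### Lexicographically first maximal independent sets -/

namespace DGraph

variable {V W : Type} {G : DGraph V} {H : DGraph W} {lt : V → V → Prop} {lt' : W → W → Prop}
  {φ : V → W} {I J : Set V}

/-- `I` precedes `J` lexicographically: the first vertex on which they differ belongs to `I`. -/
def LexPrecedes (lt : V → V → Prop) (I J : Set V) : Prop :=
  ∃ v ∈ I, v ∉ J ∧ ∀ w, lt w v → (w ∈ I ↔ w ∈ J)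

/-- `I` is the outcome of the greedy algorithm: a vertex belongs to `I` exactly if it is not
adjacent to an earlier member of `I`. -/
def IsGreedy (G : DGraph V) (lt : V → V → Prop) (I : Set V) : Prop :=
  ∀ v, v ∈ I ↔ v ∈ G.verts ∧ ∀ u ∈ I, lt u v → ¬ G.Edge u v ∧ ¬ G.Edge v u

theorem LexPrecedes.asymm (hIJ : LexPrecedes lt I J) (hI : I ⊆ G.verts) (hJ : J ⊆ G.verts)
    (htri : ∀ u ∈ G.verts, ∀ v ∈ G.verts, lt u v ∨ u = v ∨ lt v u) : ¬ LexPrecedes lt J I := by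
  obtain ⟨v, hvI, hvJ, hv⟩ := hIJ
  rintro ⟨u, huJ, huI, hu⟩
  rcases htri u (hJ huJ) v (hI hvI) with huv | rfl | hvu
  · exact huI ((hv u huv).2 huJ)
  · exact huI hvI
  · exact hvJ ((hu v hvu).2 hvI)

theorem IsLFMIS.lfmis_eq (hI : G.IsLFMIS lt I)
    (htri : ∀ u ∈ G.verts, ∀ v ∈ G.verts, lt u v ∨ u = v ∨ lt v u) : G.lfmis lt = I := by
  have eq_of_isLFMIS : ∀ J, G.IsLFMIS lt J → J = I := fun J hJ => by
    by_contra hne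
    exact LexPrecedes.asymm (hI.2 J hJ.1 hne) hI.1.1.1 hJ.1.1.1 htri (hJ.2 I hI.1 (Ne.symm hne))
  exact Set.ext fun w => ⟨fun ⟨J, hJ, hw⟩ => eq_of_isLFMIS J hJ ▸ hw, fun hw => ⟨I, hI, hw⟩⟩

theorem IsGreedy.subset_verts (hI : G.IsGreedy lt I) : I ⊆ G.verts :=
  fun v hv => ((hI v).1 hv).1

theorem IsGreedy.isIndep (hI : G.IsGreedy lt I)
    (htri : ∀ u ∈ G.verts, ∀ v ∈ G.verts, lt u v ∨ u = v ∨ lt v u) : G.IsIndep I := by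
  refine ⟨hI.subset_verts, fun u hu v hv hne => ?_⟩
  rcases htri u (hI.subset_verts hu) v (hI.subset_verts hv) with huv | rfl | hvu
  · exact (((hI v).1 hv).2 u hu huv).1
  · exact absurd rfl hne
  · exact (((hI u).1 hu).2 v hv hvu).2

theorem IsGreedy.mem_of_isIndep (hI : G.IsGreedy lt I) (hJ : G.IsIndep J) {v : V} (hv : v ∈ J)
    (hlt : ∀ u ∈ I, lt u v → u ∈ J) : v ∈ I := by
  by_contra hvI
  refine hvI ((hI v).2 ⟨hJ.1 hv, fun u hu huv => ?_⟩)
  have hne : u ≠ v := fun h => hvI (h ▸ hu)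
  exact ⟨hJ.2 u (hlt u hu huv) v hv hne, hJ.2 v hv u (hlt u hu huv) hne.symm⟩

theorem IsGreedy.isMaxIndep (hI : G.IsGreedy lt I)
    (htri : ∀ u ∈ G.verts, ∀ v ∈ G.verts, lt u v ∨ u = v ∨ lt v u) : G.IsMaxIndep I := by
  refine ⟨hI.isIndep htri, fun J hIJ hJ => ?_⟩
  obtain ⟨v, hvJ, hvI⟩ := Set.exists_of_ssubset hIJ
  exact hvI (hI.mem_of_isIndep hJ hvJ fun u hu _ => hIJ.1 hu)

theorem IsGreedy.lexPrecedes (hI : G.IsGreedy lt I) (hwf : G.verts.WellFoundedOn lt)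
    (hJ : G.IsIndep J) (hne : J ≠ I) : LexPrecedes lt I J := by
  classical
  by_contra hnot
  have agree_of_not_mem {w : V} (hw : w ∉ G.verts) : w ∈ I ↔ w ∈ J :=
    iff_of_false (fun h => hw (hI.subset_verts h)) (fun h => hw (hJ.1 h))
  have agree_of_mem {v : V} (hv : v ∈ G.verts) : v ∈ I ↔ v ∈ J := by
    refine hwf.induction (P := fun v => v ∈ I ↔ v ∈ J) hv fun v _ ih => ?_
    have agree_below : ∀ w, lt w v → (w ∈ I ↔ w ∈ J) := fun w hw =>
      if hwG : w ∈ G.verts then ih w hwG hw else agree_of_not_mem hwG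
    refine ⟨fun hvI => ?_, fun hvJ => hI.mem_of_isIndep hJ hvJ fun u hu huv =>
      (agree_below u huv).1 hu⟩
    by_contra hvJ
    exact hnot ⟨v, hvI, hvJ, agree_below⟩
  exact hne (Set.ext fun v =>
    if hv : v ∈ G.verts then (agree_of_mem hv).symm else (agree_of_not_mem hv).symm)

theorem IsGreedy.lfmis_eq (hI : G.IsGreedy lt I) (hwf : G.verts.WellFoundedOn lt)
    (htri : ∀ u ∈ G.verts, ∀ v ∈ G.verts, lt u v ∨ u = v ∨ lt v u) : G.lfmis lt = I :=
  IsLFMIS.lfmis_eq ⟨hI.isMaxIndep htri, fun _ hJ hne => hI.lexPrecedes hwf hJ.1 hne⟩ htri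

theorem IsOrderedIso.isIndep_image_iff (h : G.IsOrderedIso lt H lt' φ) (hI : I ⊆ G.verts) :
    H.IsIndep (φ '' I) ↔ G.IsIndep I := by
  have hφI : φ '' I ⊆ H.verts := (Set.image_mono hI).trans h.1.mapsTo.image_subset
  simp only [IsIndep, hI, hφI, true_and, Set.forall_mem_image]
  refine forall₂_congr fun u hu => forall₂_congr fun v hv => ?_
  rw [h.1.injOn.ne_iff (hI hu) (hI hv), (h.2 u (hI hu) v (hI hv)).1]

theorem IsOrderedIso.isMaxIndep_image_iff (h : G.IsOrderedIso lt H lt' φ) (hI : I ⊆ G.verts) :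
    H.IsMaxIndep (φ '' I) ↔ G.IsMaxIndep I := by
  refine and_congr (h.isIndep_image_iff hI) ⟨fun hmax J hIJ hJ => ?_, fun hmax K hIK hK => ?_⟩
  · exact hmax (φ '' J) ((h.1.injOn.image_ssubset_image_iff hI hJ.1).2 hIJ)
      ((h.isIndep_image_iff hJ.1).2 hJ)
  · obtain ⟨J, hJ, rfl⟩ := Set.subset_image_iff.1 (hK.1.trans h.1.image_eq.superset)
    exact hmax J ((h.1.injOn.image_ssubset_image_iff hI hJ).1 hIK)
      ((h.isIndep_image_iff hJ).1 hK)

theorem IsOrderedIso.lexPrecedes_image_iff (h : G.IsOrderedIso lt H lt' φ) (hI : I ⊆ G.verts)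
    (hJ : J ⊆ G.verts) : LexPrecedes lt' (φ '' I) (φ '' J) ↔ LexPrecedes lt I J := by
  have mem_image {K : Set V} (hK : K ⊆ G.verts) {v : V} (hv : v ∈ G.verts) :
      φ v ∈ φ '' K ↔ v ∈ K := h.1.injOn.mem_image_iff hK hv
  simp only [LexPrecedes, Set.exists_mem_image]
  refine exists_congr fun v => and_congr_right fun hv => ?_
  rw [mem_image hJ (hI hv)]
  refine and_congr_right fun _ => ⟨fun hagree w hw => ?_, fun hagree w' hw' => ?_⟩
  · by_cases hwG : w ∈ G.verts
    · simpa only [mem_image hI hwG, mem_image hJ hwG] using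
        hagree (φ w) ((h.2 w hwG v (hI hv)).2.1 hw)
    · exact iff_of_false (fun hwI => hwG (hI hwI)) (fun hwJ => hwG (hJ hwJ))
  · by_cases hwH : w' ∈ H.verts
    · obtain ⟨w, hwG, rfl⟩ := h.1.surjOn hwH
      rw [mem_image hI hwG, mem_image hJ hwG]
      exact hagree w ((h.2 w hwG v (hI hv)).2.2 hw')
    · exact iff_of_false (fun hwI => hwH (h.1.mapsTo.image_subset (Set.image_mono hI hwI)))
        (fun hwJ => hwH (h.1.mapsTo.image_subset (Set.image_mono hJ hwJ)))

theorem IsOrderedIso.isLFMIS_image_iff (h : G.IsOrderedIso lt H lt' φ) (hI : I ⊆ G.verts) :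
    H.IsLFMIS lt' (φ '' I) ↔ G.IsLFMIS lt I := by
  refine and_congr (h.isMaxIndep_image_iff hI)
    ⟨fun hfirst J hJ hne => ?_, fun hfirst K hK hne => ?_⟩
  · exact (h.lexPrecedes_image_iff hI hJ.1.1).1 (hfirst (φ '' J)
      ((h.isMaxIndep_image_iff hJ.1.1).2 hJ) fun heq => hne
        ((h.1.injOn.image_eq_image_iff hJ.1.1 hI).1 heq))
  · obtain ⟨J, hJ, rfl⟩ := Set.subset_image_iff.1 (hK.1.1.trans h.1.image_eq.superset)
    exact (h.lexPrecedes_image_iff hI hJ).2 (hfirst J ((h.isMaxIndep_image_iff hJ).1 hK)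
      fun heq => hne (heq ▸ rfl))

theorem IsOrderedIso.mem_lfmis_iff (h : G.IsOrderedIso lt H lt' φ) {v : V} (hv : v ∈ G.verts) :
    φ v ∈ H.lfmis lt' ↔ v ∈ G.lfmis lt := by
  refine ⟨fun ⟨K, hK, hvK⟩ => ?_, fun ⟨I, hI, hvI⟩ => ?_⟩
  · obtain ⟨I, hI, rfl⟩ := Set.subset_image_iff.1 (hK.1.1.1.trans h.1.image_eq.superset)
    exact ⟨I, (h.isLFMIS_image_iff hI).1 hK, (h.1.injOn.mem_image_iff hI hv).1 hvK⟩
  · exact ⟨φ '' I, (h.isLFMIS_image_iff hI.1.1.1).2 hI, Set.mem_image_of_mem φ hvI⟩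

end DGraph

/-! ### Runs of Turing machines -/

/-- A head move in the given direction from cell `j` to cell `j'`, stated without subtraction so
that no left move leaves the leftmost cell `0`. -/
def Dir.IsMove : Dir → ℕ → ℕ → Prop
  | .R, j, j' => j' = j + 1
  | .L, j, j' => j' + 1 = j

namespace Dir.IsMove

variable {d d' : Dir} {j j' j'' : ℕ}

theorem ne (h : d.IsMove j j') : j' ≠ j := by
  cases d <;> simp only [IsMove] at h <;> omega

theorem le_succ (h : d.IsMove j j') : j' ≤ j + 1 := by
  cases d <;> simp only [IsMove] at h <;> omega

theorem target_unique (h : d.IsMove j j') (h' : d.IsMove j j'') : j' = j'' := by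
  cases d <;> simp only [IsMove] at h h' <;> omega

theorem dir_unique (h : d.IsMove j j') (h' : d'.IsMove j j') : d = d' := by
  cases d <;> cases d' <;> simp only [IsMove] at h h' <;> first | rfl | omega

end Dir.IsMove

namespace TM

variable {α Q Γ : Type} {M : TM α Q Γ} {x : List α} {c c' : Cfg Q Γ} {s s' : ℕ}

theorem step_of_halting (h : M.Halting c.state) : M.step c = none := if_pos h

theorem step_eq_some_iff : M.step c = some c' ↔ ¬ M.Halting c.state ∧
    c'.state = (M.δ c.state (c.tape c.head)).1 ∧
    c'.tape = Function.update c.tape c.head (M.δ c.state (c.tape c.head)).2.1 ∧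
    (M.δ c.state (c.tape c.head)).2.2.IsMove c.head c'.head := by
  obtain ⟨q, j, t⟩ := c
  obtain ⟨q', j', t'⟩ := c'
  obtain hh | hh := em (M.Halting q)
  · simp [step, hh]
  · rcases hδ : M.δ q (t j) with ⟨p, a, _ | _⟩ <;> cases j <;>
      simp [step, hh, hδ, Dir.IsMove, eq_comm, and_comm]

theorem step_eq_some_of_δ_eq {q : Q} {a : Γ} {d : Dir} {j : ℕ} (hh : ¬ M.Halting c.state)
    (hδ : M.δ c.state (c.tape c.head) = (q, a, d)) (hmove : d.IsMove c.head j) :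
    M.step c = some ⟨q, j, Function.update c.tape c.head a⟩ := by
  rw [step_eq_some_iff, hδ]
  exact ⟨hh, rfl, rfl, hmove⟩

theorem run_succ_eq_some_iff :
    M.run x (s + 1) = some c' ↔ ∃ c, M.run x s = some c ∧ M.step c = some c' :=
  Option.bind_eq_some_iff

theorem run_add_of_halting (hc : M.run x s = some c) (h : M.Halting c.state) (d : ℕ) :
    M.run x (s + d + 1) = none := by
  induction d with
  | zero => simp [run, hc, step_of_halting h]
  | succ d ih => rw [← add_assoc, run, ih, Option.bind_none]

theorem halting_unique (hc : M.run x s = some c) (h : M.Halting c.state)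
    (hc' : M.run x s' = some c') (h' : M.Halting c'.state) : c = c' := by
  rcases lt_trichotomy s s' with hs | rfl | hs
  · obtain ⟨d, rfl⟩ := Nat.exists_eq_add_of_lt hs
    simp [run_add_of_halting hc h d] at hc'
  · exact Option.some.inj (hc.symm.trans hc')
  · obtain ⟨d, rfl⟩ := Nat.exists_eq_add_of_lt hs
    simp [run_add_of_halting hc' h' d] at hc

theorem accepts_iff_of_halting (hc : M.run x s = some c) (h : M.Halting c.state) :
    M.Accepts x ↔ c.state = M.qacc := by
  refine ⟨fun ⟨s', c', hc', hacc⟩ => ?_, fun hacc => ⟨s, c, hc, hacc⟩⟩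
  rw [halting_unique hc h hc' (Or.inl hacc), hacc]

theorem exists_run_of_le (hc : M.run x s = some c) {i : ℕ} (hi : i ≤ s) :
    ∃ c', M.run x i = some c' := by
  induction hi using Nat.decreasingInduction with
  | self => exact ⟨c, hc⟩
  | of_succ i _ ih =>
    obtain ⟨_, h⟩ := ih
    obtain ⟨c', hc', -⟩ := run_succ_eq_some_iff.1 h
    exact ⟨c', hc'⟩

theorem head_le_succ_of_step (h : M.step c = some c') : c'.head ≤ c.head + 1 :=
  (step_eq_some_iff.1 h).2.2.2.le_succ

theorem head_le_of_run (hc : M.run x s = some c) : c.head ≤ s := by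
  induction s generalizing c with
  | zero => exact (congrArg Cfg.head (Option.some.inj hc)).ge
  | succ s ih =>
    obtain ⟨c', hc', h⟩ := run_succ_eq_some_iff.1 hc
    exact (head_le_succ_of_step h).trans (Nat.succ_le_succ (ih hc'))

/-- `c` is the sequence of configurations of `M` on input `x`, continued forever from a halting
one. -/
structure IsFrozenRun (M : TM α Q Γ) (x : List α) (c : ℕ → Cfg Q Γ) : Prop where
  zero : c 0 = M.init x
  succ_of_halting : ∀ i, M.Halting (c i).state → c (i + 1) = c i
  step_of_not_halting : ∀ i, ¬ M.Halting (c i).state → M.step (c i) = some (c (i + 1))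

theorem exists_isFrozenRun (hs : M.run x s = some c) (hc : M.Halting c.state) :
    ∃ cs, M.IsFrozenRun x cs ∧ ∀ i, s ≤ i → cs i = c := by
  choose cs hcs using fun i => exists_run_of_le hs (min_le_right i s)
  have run_eq : ∀ i ≤ s, M.run x i = some (cs i) := fun i hi => by
    simpa only [min_eq_left hi] using hcs i
  have eq_final : ∀ i, s ≤ i → cs i = c := fun i hi => by
    simpa only [min_eq_right hi, hs, Option.some.injEq, eq_comm] using hcs i
  have step_of_lt : ∀ i < s, M.step (cs i) = some (cs (i + 1)) := fun i hi => by
    simpa only [run, run_eq i hi.le, Option.bind_some] using run_eq (i + 1) hi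
  refine ⟨cs, ⟨?_, fun i hh => ?_, fun i hh => ?_⟩, eq_final⟩
  · exact (Option.some.inj (run_eq 0 s.zero_le)).symm
  · rcases Nat.lt_or_ge i s with hi | hi
    · exact absurd (step_of_lt i hi) (by simp [step_of_halting hh])
    · rw [eq_final i hi, eq_final (i + 1) (hi.trans i.le_succ)]
  · rcases Nat.lt_or_ge i s with hi | hi
    · exact step_of_lt i hi
    · exact absurd (eq_final i hi ▸ hc) hh

theorem IsFrozenRun.head_le {c : ℕ → Cfg Q Γ} (hc : M.IsFrozenRun x c) (i : ℕ) :
    (c i).head ≤ i := by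
  induction i with
  | zero => exact (congrArg Cfg.head hc.zero).le
  | succ i ih =>
    by_cases hh : M.Halting (c i).state
    · exact (hc.succ_of_halting i hh) ▸ ih.trans i.le_succ
    · exact (head_le_succ_of_step (hc.step_of_not_halting i hh)).trans (Nat.succ_le_succ ih)

end TM

/-! ### The order on tiles and nodes -/

theorem mul_add_lt_mul_add_iff {N p q a b : ℕ} (ha : a < N) (hb : b < N) :
    p * N + a < q * N + b ↔ p < q ∨ p = q ∧ a < b := by
  rcases lt_trichotomy p q with hpq | rfl | hqp
  · have : (p + 1) * N ≤ q * N := Nat.mul_le_mul_right N hpq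
    rw [add_one_mul] at this
    omega
  · simp
  · have : (q + 1) * N ≤ p * N := Nat.mul_le_mul_right N hqp
    rw [add_one_mul] at this
    omega

namespace TM.Numbering

variable {α Q Γ : Type} [Fintype Q] [Fintype Γ] {M : TM α Q Γ} (ν : M.Numbering) {n : ℕ}

theorem xstateIdx_lt (p : XState Q) : ν.xstateIdx p < Fintype.card Q + 2 := by
  cases p <;> simp [xstateIdx]

theorem xsymIdx_lt (a : XSym Γ n) : ν.xsymIdx a < Fintype.card Γ + n := by
  cases a <;> simp only [xsymIdx] <;> omega

theorem exists_xstateIdx_eq {m : ℕ} (hm : m < Fintype.card Q + 2) : ∃ p, ν.xstateIdx p = m := by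
  match m with
  | 0 => exact ⟨.start, rfl⟩
  | 1 => exact ⟨.star, rfl⟩
  | m + 2 => exact ⟨.st (ν.stateIdx.symm ⟨m, by omega⟩), by simp [xstateIdx]⟩

theorem exists_xsymIdx_eq {m : ℕ} (hm : m < Fintype.card Γ + n) :
    ∃ a : XSym Γ n, ν.xsymIdx a = m := by
  rcases Nat.lt_or_ge m n with hmn | hnm
  · exact ⟨.special ⟨m, hmn⟩, rfl⟩
  · exact ⟨.sym (ν.symIdx.symm ⟨m - n, by omega⟩), by simp [xsymIdx, hnm]⟩

theorem xstateIdx_injective : Function.Injective ν.xstateIdx := by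
  rintro (_ | _ | p) (_ | _ | q) h <;> simp_all [xstateIdx, Fin.val_inj]

theorem xsymIdx_injective : Function.Injective (ν.xsymIdx : XSym Γ n → ℕ) := by
  rintro (i | a) (j | b) h <;> simp only [xsymIdx] at h
  · rw [Fin.ext h]
  · omega
  · omega
  · rw [ν.symIdx.injective (Fin.ext (Nat.add_left_cancel h))]

theorem star_le_of_mem_plainStates {p : XState Q} (hp : p ∈ plainStates Q) :
    ν.xstateIdx .star ≤ ν.xstateIdx p := by
  cases p with
  | start => exact absurd rfl hp
  | star => exact le_rfl
  | st q => simp [xstateIdx]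

theorem blank_le_of_mem_plainSyms {a : XSym Γ n} (ha : a ∈ plainSyms Γ n) :
    ν.xsymIdx (.sym M.blank : XSym Γ n) ≤ ν.xsymIdx a := by
  obtain ⟨a, rfl⟩ := ha
  simp [xsymIdx, ν.symIdx_blank]

theorem special_lt_of_mem_plainSyms (i : Fin n) {a : XSym Γ n} (ha : a ∈ plainSyms Γ n) :
    ν.xsymIdx (.special i : XSym Γ n) < ν.xsymIdx a := by
  obtain ⟨a, rfl⟩ := ha
  exact Nat.lt_add_right _ i.isLt

theorem tileIdx_lt_tileIdx_iff (t t' : Tile Q Γ n) : ν.tileIdx t < ν.tileIdx t' ↔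
    ν.xstateIdx t.1 < ν.xstateIdx t'.1 ∨
      ν.xstateIdx t.1 = ν.xstateIdx t'.1 ∧ ν.xsymIdx t.2 < ν.xsymIdx t'.2 :=
  mul_add_lt_mul_add_iff (ν.xsymIdx_lt t.2) (ν.xsymIdx_lt t'.2)

theorem tileIdx_le_tileIdx {t t' : Tile Q Γ n} (hstate : ν.xstateIdx t.1 ≤ ν.xstateIdx t'.1)
    (hsym : ν.xsymIdx t.2 ≤ ν.xsymIdx t'.2) : ν.tileIdx t ≤ ν.tileIdx t' :=
  Nat.add_le_add (Nat.mul_le_mul_right _ hstate) hsym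

theorem tileIdx_injective : Function.Injective (ν.tileIdx : Tile Q Γ n → ℕ) := by
  intro t t' h
  have hlt := (ν.tileIdx_lt_tileIdx_iff t t').not.1 h.not_lt
  have hgt := (ν.tileIdx_lt_tileIdx_iff t' t).not.1 h.not_gt
  exact Prod.ext (ν.xstateIdx_injective (by omega)) (ν.xsymIdx_injective (by omega))

theorem tileIdx_lt (t : Tile Q Γ n) : ν.tileIdx t < ν.tileCount n := by
  rw [← Nat.add_zero (ν.tileCount n)]
  exact (mul_add_lt_mul_add_iff (ν.xsymIdx_lt t.2) ((Nat.zero_le _).trans_lt (ν.xsymIdx_lt t.2))).2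
    (Or.inl (ν.xstateIdx_lt t.1))

theorem exists_tileIdx_eq {m : ℕ} (hm : m < ν.tileCount n) : ∃ t : Tile Q Γ n, ν.tileIdx t = m := by
  have hpos : 0 < Fintype.card Γ + n := Nat.pos_of_mul_pos_left ((Nat.zero_le m).trans_lt hm)
  obtain ⟨p, hp⟩ := ν.exists_xstateIdx_eq ((Nat.div_lt_iff_lt_mul hpos).2 hm)
  obtain ⟨a, ha⟩ := ν.exists_xsymIdx_eq (Nat.mod_lt m hpos)
  exact ⟨(p, a), by rw [tileIdx, hp, ha, Nat.div_add_mod']⟩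

theorem prec_iff (u v : Node Q Γ n) : ν.prec u v ↔ u.row < v.row ∨ u.row = v.row ∧
    (u.col < v.col ∨ u.col = v.col ∧ ν.tileIdx u.tile < ν.tileIdx v.tile) := by
  simp [prec, Prod.Lex.toLex_lt_toLex, tileIdx_lt_tileIdx_iff]

theorem prec_trichotomy (u v : Node Q Γ n) : ν.prec u v ∨ u = v ∨ ν.prec v u := by
  obtain ⟨i, j, t⟩ := u
  obtain ⟨i', j', t'⟩ := v
  have eq_of_tileIdx_eq : ν.tileIdx t = ν.tileIdx t' → t = t' := fun h => ν.tileIdx_injective h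
  simp only [prec_iff, Node.mk.injEq]
  grind

theorem prec_wellFounded : WellFounded (ν.prec : Node Q Γ n → Node Q Γ n → Prop) :=
  InvImage.wf (fun u : Node Q Γ n =>
    toLex (u.row, toLex (u.col, toLex (ν.xstateIdx u.tile.1, ν.xsymIdx u.tile.2)))) wellFounded_lt

theorem prec_of_isParent {D : GDir} {u v : Node Q Γ n}
    (h : IsParent D (u.row, u.col) (v.row, v.col)) : ν.prec u v := by
  rw [prec_iff]
  cases D <;> simp only [IsParent] at h <;> omega

end TM.Numbering

/-! ### The space-time diagram -/

namespace TM

variable {α Q Γ : Type} {M : TM α Q Γ} {x : List α} {c : ℕ → Cfg Q Γ}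

open Classical in
/-- The tile in row `i` and column `j`, both counted from `0`, of the space-time diagram of the
configurations `c`: the symbol in cell `j` at time `i`, with the state if the head is there. Row
`0` carries the special symbols. -/
noncomputable def tileAt (M : TM α Q Γ) (x : List α) (c : ℕ → Cfg Q Γ) :
    ℕ → ℕ → Tile Q Γ x.length
  | 0, j => (if j = 0 then .start else .star,
      if h : j < x.length then .special ⟨j, h⟩ else .sym M.blank)
  | i + 1, j => (if (c (i + 1)).head = j then .st (c (i + 1)).state else .star,
      .sym ((c (i + 1)).tape j))

/-- The vertices of the space-time diagram of `c`, one in each supernode of the `T × T` grid. -/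
def diagram (M : TM α Q Γ) (x : List α) (T : ℕ) (c : ℕ → Cfg Q Γ) : Set (Node Q Γ x.length) :=
  {v | v ∈ gridVerts Q Γ x.length T ∧ v.tile = M.tileAt x c (v.row - 1) (v.col - 1)}

open Classical in
theorem unstar_tileAt (hc : M.IsFrozenRun x c) (i j : ℕ) :
    M.unstar (M.tileAt x c i j).1 = if (c i).head = j then some (c i).state else none := by
  cases i with
  | zero => cases j <;> simp [tileAt, hc.zero, init, unstar]
  | succ i => by_cases h : (c (i + 1)).head = j <;> simp [tileAt, h, unstar]

theorem undot_tileAt (hc : M.IsFrozenRun x c) (i j : ℕ) :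
    M.undot x (M.tileAt x c i j).2 = (c i).tape j := by
  cases i with
  | zero => by_cases h : j < x.length <;> simp [tileAt, hc.zero, init, h, undot]
  | succ i => rfl

theorem tileAt_succ_fst_mem_plainStates (i j : ℕ) :
    (M.tileAt x c (i + 1) j).1 ∈ plainStates Q := by
  by_cases h : (c (i + 1)).head = j <;> simp [tileAt, h, plainStates]

theorem tileAt_succ_snd_mem_plainSyms (i j : ℕ) :
    (M.tileAt x c (i + 1) j).2 ∈ plainSyms Γ x.length := ⟨_, rfl⟩

open Classical in
theorem consV_tileAt (hc : M.IsFrozenRun x c) (i j : ℕ) :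
    M.consV x (M.tileAt x c i j) = if (c i).head = j then {M.tileAt x c (i + 1) j}
      else plainStates Q ×ˢ {.sym ((c (i + 1)).tape j)} := by
  unfold consV
  rw [unstar_tileAt hc, undot_tileAt hc]
  by_cases hh : M.Halting (c i).state
  · by_cases hj : (c i).head = j <;> simp [hh, hj, tileAt, hc.succ_of_halting i hh]
  · obtain ⟨-, -, htape, hmove⟩ := step_eq_some_iff.1 (hc.step_of_not_halting i hh)
    by_cases hj : (c i).head = j
    · simp only [hj, if_pos, if_neg hh, tileAt, if_neg (hj ▸ hmove.ne), htape,
        Function.update_self]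
    · simp only [if_neg hj, htape, Function.update_of_ne (Ne.symm hj)]

open Classical in
theorem consDiag_tileAt (hc : M.IsFrozenRun x c) (d : Dir) (i j : ℕ) :
    M.consDiag x d (M.tileAt x c i j) =
      (if (c i).head = j ∧ ¬ M.Halting (c i).state then
        if (M.δ (c i).state ((c i).tape j)).2.2 = d then {.st (c (i + 1)).state} else {.star}
      else plainStates Q) ×ˢ plainSyms Γ x.length := by
  unfold consDiag
  rw [unstar_tileAt hc, undot_tileAt hc]
  by_cases hj : (c i).head = j
  · subst hj
    by_cases hh : M.Halting (c i).state
    · simp [hh]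
    · have hstate := (step_eq_some_iff.1 (hc.step_of_not_halting i hh)).2.1
      simp only [hh, if_true, if_false, true_and, not_false_eq_true, hstate]
      split_ifs <;> rfl
  · simp [hj]

theorem tileAt_mem_consV (hc : M.IsFrozenRun x c) (i j : ℕ) :
    M.tileAt x c (i + 1) j ∈ M.consV x (M.tileAt x c i j) := by
  rw [consV_tileAt hc]
  split_ifs
  · rfl
  · exact ⟨tileAt_succ_fst_mem_plainStates i j, rfl⟩

theorem tileAt_mem_consH (i j : ℕ) : M.tileAt x c i (j + 1) ∈ consH x (M.tileAt x c i j) := by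
  cases i with
  | zero =>
    have hstar : (M.tileAt x c 0 (j + 1)).1 ∈ plainStates Q := by simp [tileAt, plainStates]
    by_cases hj : j + 1 < x.length
    · have hj' : j < x.length := by omega
      simp only [consH, tileAt, hj', dite_true]
      exact ⟨hstar, Or.inr ⟨⟨j + 1, hj⟩, rfl, by simp [hj]⟩⟩
    · have hplain : (M.tileAt x c 0 (j + 1)).2 ∈ plainSyms Γ x.length :=
        ⟨M.blank, by simp [tileAt, hj]⟩
      unfold consH
      split
      · exact ⟨hstar, Or.inl hplain⟩
      · exact ⟨hstar, hplain⟩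
  | succ i => exact ⟨tileAt_succ_fst_mem_plainStates i _, tileAt_succ_snd_mem_plainSyms i _⟩

theorem tileAt_mem_consDiag (hc : M.IsFrozenRun x c) {d : Dir} (i : ℕ) {j j' : ℕ}
    (hd : d.IsMove j j') : M.tileAt x c (i + 1) j' ∈ M.consDiag x d (M.tileAt x c i j) := by
  rw [consDiag_tileAt hc]
  refine ⟨?_, tileAt_succ_snd_mem_plainSyms i j'⟩
  have isMove_head (hj : (c i).head = j) (hh : ¬ M.Halting (c i).state) :
      (M.δ (c i).state ((c i).tape j)).2.2.IsMove j (c (i + 1)).head :=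
    hj ▸ (step_eq_some_iff.1 (hc.step_of_not_halting i hh)).2.2.2
  split_ifs with hhead hdir
  · exact if_pos ((hdir ▸ isMove_head hhead.1 hhead.2).target_unique hd)
  · exact if_neg fun h => hdir ((h ▸ isMove_head hhead.1 hhead.2).dir_unique hd)
  · exact tileAt_succ_fst_mem_plainStates i j'

theorem tileAt_mem_cons (hc : M.IsFrozenRun x c) {D : GDir} {i j i' j' : ℕ}
    (h : IsParent D (i, j) (i', j')) : M.tileAt x c i' j' ∈ M.cons x D (M.tileAt x c i j) := by
  cases D <;> obtain ⟨rfl, hcol⟩ := h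
  · exact hcol ▸ tileAt_mem_consV hc i j
  · exact hcol ▸ tileAt_mem_consH i' j
  · exact tileAt_mem_consDiag hc i hcol
  · exact tileAt_mem_consDiag hc i hcol

/-! ### The space-time diagram is the outcome of the greedy algorithm -/

theorem fst_mem_plainStates_of_mem_consH {t t' : Tile Q Γ x.length} (h : t' ∈ consH x t) :
    t'.1 ∈ plainStates Q := by
  unfold consH at h
  split at h <;> exact h.1

theorem eq_tileAt_of_mem_consV (hc : M.IsFrozenRun x c) {i : ℕ} {t : Tile Q Γ x.length}
    (ht : t ∈ M.consV x (M.tileAt x c i (c i).head)) : t = M.tileAt x c (i + 1) (c i).head := by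
  simpa only [consV_tileAt hc, if_pos, Set.mem_singleton_iff] using ht

theorem fst_eq_of_mem_consDiag (hc : M.IsFrozenRun x c) {i : ℕ} (hh : ¬ M.Halting (c i).state)
    {t : Tile Q Γ x.length}
    (ht : t ∈ M.consDiag x (M.δ (c i).state ((c i).tape (c i).head)).2.2
      (M.tileAt x c i (c i).head)) : t.1 = .st (c (i + 1)).state := by
  rw [consDiag_tileAt hc, if_pos ⟨rfl, hh⟩, if_pos rfl] at ht
  exact ht.1

theorem exists_isParent_of_isMove {d : Dir} (i : ℕ) {j j' : ℕ} (h : d.IsMove j j') :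
    ∃ D, IsParent D (i, j) (i + 1, j') ∧ M.cons x D = M.consDiag x d := by
  cases d
  · exact ⟨.L, ⟨rfl, h⟩, rfl⟩
  · exact ⟨.R, ⟨rfl, h⟩, rfl⟩

section Minimality

variable [Fintype Q] [Fintype Γ] (ν : M.Numbering)

theorem tileIdx_tileAt_zero_zero : ν.tileIdx (M.tileAt x c 0 0) = 0 := by
  by_cases h : 0 < x.length
  · simp [tileAt, h, Numbering.tileIdx, Numbering.xstateIdx, Numbering.xsymIdx]
  · simp [tileAt, Numbering.tileIdx, Numbering.xstateIdx, Numbering.xsymIdx, ν.symIdx_blank,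
      Nat.eq_zero_of_not_pos h]

theorem tileIdx_tileAt_zero_succ_le {j : ℕ} {t : Tile Q Γ x.length}
    (ht : t ∈ consH x (M.tileAt x c 0 j)) : ν.tileIdx (M.tileAt x c 0 (j + 1)) ≤ ν.tileIdx t := by
  refine ν.tileIdx_le_tileIdx
    (ν.star_le_of_mem_plainStates (fst_mem_plainStates_of_mem_consH ht)) ?_
  by_cases hj : j < x.length
  · simp only [consH, tileAt, hj, dite_true] at ht
    rcases ht.2 with hplain | ⟨i, hi, hspecial⟩
    · by_cases hj' : j + 1 < x.length
      · simpa only [tileAt, hj', dite_true] using (ν.special_lt_of_mem_plainSyms _ hplain).le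
      · simpa only [tileAt, hj', dite_false] using ν.blank_le_of_mem_plainSyms hplain
    · have hj' : j + 1 < x.length := hi ▸ i.isLt
      simp only [tileAt, hj', dite_true, hspecial, Numbering.xsymIdx, hi, le_refl]
  · have hj' : ¬ j + 1 < x.length := by omega
    simp only [consH, tileAt, hj, dite_false] at ht
    simpa only [tileAt, hj', dite_false] using ν.blank_le_of_mem_plainSyms ht.2

theorem tileIdx_tileAt_succ_le (hc : M.IsFrozenRun x c) {i j : ℕ} {t : Tile Q Γ x.length}
    (ht : ∀ D j', IsParent D (i, j') (i + 1, j) → j' ≤ max i j →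
      t ∈ M.cons x D (M.tileAt x c i j')) :
    ν.tileIdx (M.tileAt x c (i + 1) j) ≤ ν.tileIdx t := by
  have htV : t ∈ M.consV x (M.tileAt x c i j) := ht .V j ⟨rfl, rfl⟩ (le_max_right i j)
  by_cases hj : (c i).head = j
  · subst hj
    rw [eq_tileAt_of_mem_consV hc htV]
  rw [consV_tileAt hc, if_neg hj] at htV
  refine ν.tileIdx_le_tileIdx ?_ (le_of_eq (congrArg _ htV.2.symm))
  by_cases hj' : (c (i + 1)).head = j
  · have hh : ¬ M.Halting (c i).state := fun hh => hj (hc.succ_of_halting i hh ▸ hj')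
    obtain ⟨-, -, -, hmove⟩ := step_eq_some_iff.1 (hc.step_of_not_halting i hh)
    obtain ⟨D, hD, hcons⟩ := exists_isParent_of_isMove (M := M) (x := x) i (hj' ▸ hmove)
    have htD := ht D (c i).head hD (le_max_of_le_left (hc.head_le i))
    rw [hcons] at htD
    rw [fst_eq_of_mem_consDiag hc hh htD, tileAt, if_pos hj']
  · rw [tileAt, if_neg hj']
    exact ν.star_le_of_mem_plainStates htV.1

theorem tileIdx_tileAt_le (hc : M.IsFrozenRun x c) {i j : ℕ} {t : Tile Q Γ x.length}
    (ht : ∀ D i' j', IsParent D (i', j') (i, j) → i' ≤ i → j' ≤ max i j →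
      t ∈ M.cons x D (M.tileAt x c i' j')) :
    ν.tileIdx (M.tileAt x c i j) ≤ ν.tileIdx t := by
  match i, j with
  | 0, 0 => exact (tileIdx_tileAt_zero_zero ν).trans_le (Nat.zero_le _)
  | 0, j + 1 => exact tileIdx_tileAt_zero_succ_le ν (ht .H 0 j ⟨rfl, rfl⟩ le_rfl (by omega))
  | i + 1, j =>
    exact tileIdx_tileAt_succ_le ν hc fun D j' hD hj' => ht D i j' hD (by omega) (by omega)

end Minimality

end TM

/-! ### The grid graph -/

theorem isParent_add_one_iff {D : GDir} {i j i' j' : ℕ} :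
    IsParent D (i + 1, j + 1) (i' + 1, j' + 1) ↔ IsParent D (i, j) (i', j') := by
  cases D <;> simp only [IsParent] <;> omega

theorem mem_gridVerts_iff {Q Γ : Type} {n T : ℕ} {v : Node Q Γ n} :
    v ∈ gridVerts Q Γ n T ↔ ∃ i < T, ∃ j < T, ∃ t, v = ⟨i + 1, j + 1, t⟩ := by
  constructor
  · obtain ⟨i, j, t⟩ := v
    rintro ⟨hi, hiT, hj, hjT⟩
    dsimp only at hi hiT hj hjT
    exact ⟨i - 1, by omega, j - 1, by omega, t,
      by rw [Nat.sub_add_cancel hi, Nat.sub_add_cancel hj]⟩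
  · rintro ⟨i, hi, j, hj, t, rfl⟩
    exact ⟨Nat.le_add_left 1 i, hi, Nat.le_add_left 1 j, hj⟩

namespace TM

variable {α Q Γ : Type} {M : TM α Q Γ} {x : List α} {c : ℕ → Cfg Q Γ} {T : ℕ}

theorem gridGraph_edge_iff {i j i' j' : ℕ} (hi : i < T) (hj : j < T) (hi' : i' < T) (hj' : j' < T)
    (t t' : Tile Q Γ x.length) :
    (M.gridGraph x T).Edge ⟨i + 1, j + 1, t⟩ ⟨i' + 1, j' + 1, t'⟩ ↔
      (i = i' ∧ j = j' ∧ t ≠ t') ∨ ∃ D, IsParent D (i, j) (i', j') ∧ t' ∉ M.cons x D t := by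
  have hu : ⟨i + 1, j + 1, t⟩ ∈ gridVerts Q Γ x.length T :=
    mem_gridVerts_iff.2 ⟨i, hi, j, hj, t, rfl⟩
  have hv : ⟨i' + 1, j' + 1, t'⟩ ∈ gridVerts Q Γ x.length T :=
    mem_gridVerts_iff.2 ⟨i', hi', j', hj', t', rfl⟩
  simp only [gridGraph, hu, hv, true_and, isParent_add_one_iff, ne_eq, Node.mk.injEq,
    Nat.add_right_cancel_iff]
  grind

theorem mem_diagram_iff {i j : ℕ} {t : Tile Q Γ x.length} :
    ⟨i + 1, j + 1, t⟩ ∈ M.diagram x T c ↔ i < T ∧ j < T ∧ t = M.tileAt x c i j := by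
  simp [diagram, gridVerts, Nat.succ_le_iff, and_assoc]

theorem not_edge_of_mem_diagram (hc : M.IsFrozenRun x c) {u v : Node Q Γ x.length}
    (hu : u ∈ M.diagram x T c) (hv : v ∈ M.diagram x T c) : ¬ (M.gridGraph x T).Edge u v := by
  obtain ⟨i, hi, j, hj, t, rfl⟩ := mem_gridVerts_iff.1 hu.1
  obtain ⟨i', hi', j', hj', t', rfl⟩ := mem_gridVerts_iff.1 hv.1
  obtain rfl := (mem_diagram_iff.1 hu).2.2
  obtain rfl := (mem_diagram_iff.1 hv).2.2
  rw [gridGraph_edge_iff hi hj hi' hj']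
  rintro (⟨rfl, rfl, hne⟩ | ⟨D, hD, hcons⟩)
  · exact hne rfl
  · exact hcons (tileAt_mem_cons hc hD)

theorem Normalized.pos_of_halting (hM : M.Normalized) (hx : x ≠ []) {s : ℕ} {cs : Cfg Q Γ}
    (hcs : M.run x s = some cs) (hh : M.Halting cs.state) : 0 < s := by
  refine Nat.pos_of_ne_zero ?_
  rintro rfl
  obtain rfl : M.init x = cs := Option.some.inj hcs
  obtain ⟨a, y, rfl⟩ := List.exists_cons_of_ne_nil hx
  exact M.inp_ne_blank a (hM _ 0 _ hcs hh).2

variable [Fintype Q] [Fintype Γ] (ν : M.Numbering)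

theorem isGreedy_diagram (hc : M.IsFrozenRun x c) (T : ℕ) :
    (M.gridGraph x T).IsGreedy ν.prec (M.diagram x T c) := by
  refine fun v => ⟨fun hv => ⟨hv.1, fun u hu _ =>
    ⟨not_edge_of_mem_diagram hc hu hv, not_edge_of_mem_diagram hc hv hu⟩⟩, fun ⟨hv, hfree⟩ => ?_⟩
  obtain ⟨i, hi, j, hj, t, rfl⟩ := mem_gridVerts_iff.1 hv
  have mem_cons_parent : ∀ D i' j', IsParent D (i', j') (i, j) → i' ≤ i → j' ≤ max i j →
      t ∈ M.cons x D (M.tileAt x c i' j') := fun D i' j' hD hi' hj' => by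
    have hi'T : i' < T := by omega
    have hj'T : j' < T := by omega
    by_contra hcons
    exact (hfree _ (mem_diagram_iff.2 ⟨hi'T, hj'T, rfl⟩)
      (ν.prec_of_isParent (isParent_add_one_iff.2 hD))).1
        ((gridGraph_edge_iff hi'T hj'T hi hj _ _).2 (Or.inr ⟨D, hD, hcons⟩))
  refine mem_diagram_iff.2 ⟨hi, hj, by_contra fun hne => ?_⟩
  have hlt : ν.tileIdx (M.tileAt x c i j) < ν.tileIdx t :=
    (tileIdx_tileAt_le ν hc mem_cons_parent).lt_of_ne
      (ν.tileIdx_injective.ne (Ne.symm hne))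
  exact (hfree _ (mem_diagram_iff.2 ⟨hi, hj, rfl⟩)
    ((ν.prec_iff _ _).2 (Or.inr ⟨rfl, Or.inr ⟨rfl, hlt⟩⟩))).1
      ((gridGraph_edge_iff hi hj hi hj _ _).2 (Or.inl ⟨rfl, rfl, Ne.symm hne⟩))

theorem lfmis_gridGraph (hc : M.IsFrozenRun x c) (T : ℕ) :
    (M.gridGraph x T).lfmis ν.prec = M.diagram x T c :=
  (isGreedy_diagram ν hc T).lfmis_eq ν.prec_wellFounded.wellFoundedOn
    fun u _ v _ => ν.prec_trichotomy u v

theorem accepts_iff_acceptNode_mem_lfmis (hM : M.Normalized) (hx : x ≠ []) {s : ℕ}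
    (hs : s + 1 ≤ T) (hh : M.HaltsAfter x s) :
    M.Accepts x ↔ M.acceptNode x.length T ∈ (M.gridGraph x T).lfmis ν.prec := by
  obtain ⟨cs, hcs, hh⟩ := hh
  obtain ⟨c, hc, hfinal⟩ := exists_isFrozenRun hcs hh
  obtain ⟨hhead, hblank⟩ := hM x s cs hcs hh
  have hs_pos : 0 < s := hM.pos_of_halting hx hcs hh
  obtain ⟨i, rfl⟩ := Nat.exists_eq_add_of_le' (show 2 ≤ T by omega)
  have final_tile : M.tileAt x c (i + 1) 0 = (.st cs.state, .sym M.blank) := by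
    rw [tileAt, hfinal (i + 1) (by omega), if_pos hhead, hblank]
  rw [lfmis_gridGraph ν hc, accepts_iff_of_halting hcs hh, acceptNode, mem_diagram_iff, final_tile]
  simp [eq_comm]

end TM

/-! ### Words and digits -/

/-- The words of length `k` over `0, …, b - 1`: the vertices of a product of `k` input graphs of
size `b`. -/
def words (b k : ℕ) : Set (List ℕ) := {w | w.length = k ∧ ∀ d ∈ w, d < b}

theorem nil_mem_words (b : ℕ) : [] ∈ words b 0 := ⟨rfl, by simp⟩

theorem append_mem_words {b m n : ℕ} {u v : List ℕ} (hu : u ∈ words b m) (hv : v ∈ words b n) :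
    u ++ v ∈ words b (m + n) :=
  ⟨by rw [List.length_append, hu.1, hv.1],
    fun d hd => (List.mem_append.1 hd).elim (hu.2 d) (hv.2 d)⟩

theorem mem_words_add {b m n : ℕ} {w : List ℕ} :
    w ∈ words b (m + n) ↔ ∃ u ∈ words b m, ∃ v ∈ words b n, w = u ++ v := by
  refine ⟨fun ⟨hlen, hlt⟩ => ?_, fun ⟨u, hu, v, hv, h⟩ => h ▸ append_mem_words hu hv⟩
  exact ⟨w.take m, ⟨by simp [hlen], fun d hd => hlt d (List.mem_of_mem_take hd)⟩,
    w.drop m, ⟨by simp [hlen], fun d hd => hlt d (List.mem_of_mem_drop hd)⟩,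
    (List.take_append_drop m w).symm⟩

theorem mem_words_one {b : ℕ} {w : List ℕ} : w ∈ words b 1 ↔ ∃ d < b, w = [d] := by
  constructor
  · rintro ⟨hlen, hlt⟩
    obtain ⟨d, rfl⟩ := List.length_eq_one_iff.1 hlen
    exact ⟨d, hlt d (List.mem_singleton_self d), rfl⟩
  · rintro ⟨d, hd, rfl⟩
    exact ⟨rfl, by simpa using hd⟩

theorem append_lt_append_iff {u u' v v' : List ℕ} (h : u.length = u'.length) :
    u ++ v < u' ++ v' ↔ u < u' ∨ u = u' ∧ v < v' := by
  induction u generalizing u' with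
  | nil =>
    obtain rfl := List.length_eq_zero_iff.1 h.symm
    simp
  | cons a u ih =>
    obtain ⟨a', u', rfl⟩ := List.exists_cons_of_length_eq_add_one h.symm
    simp only [List.cons_append, List.cons_lt_cons_iff, ih (Nat.succ.inj h), List.cons.injEq]
    tauto

theorem singleton_lt_singleton_iff {d d' : ℕ} : [d] < [d'] ↔ d < d' := by
  simp [List.cons_lt_cons_iff]

theorem digits_succ (b k m : ℕ) : digits b (k + 1) m = digits b k (m / b) ++ [m % b] := by
  simp only [digits, List.range_succ_eq_map, List.reverse_cons, List.map_append, List.map_reverse,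
    List.map_map]
  simp [Function.comp_def, Nat.div_div_eq_div_mul, pow_succ']

theorem length_digits (b k m : ℕ) : (digits b k m).length = k := by
  simp [digits]

theorem digits_mem_words {b : ℕ} (hb : 0 < b) (k m : ℕ) : digits b k m ∈ words b k := by
  refine ⟨length_digits b k m, fun d hd => ?_⟩
  obtain ⟨i, -, rfl⟩ := List.mem_map.1 hd
  exact Nat.mod_lt _ hb

theorem div_lt_pow_of_lt_pow_succ {b k m : ℕ} (hm : m < b ^ (k + 1)) : m / b < b ^ k :=
  Nat.div_lt_of_lt_mul (by rwa [← pow_succ'])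

theorem digits_inj {b k m m' : ℕ} (hm : m < b ^ k) (hm' : m' < b ^ k) :
    digits b k m = digits b k m' ↔ m = m' := by
  induction k generalizing m m' with
  | zero => simp_all [digits]
  | succ k ih =>
    rw [digits_succ, digits_succ, List.append_singleton_inj,
      ih (div_lt_pow_of_lt_pow_succ hm) (div_lt_pow_of_lt_pow_succ hm')]
    refine ⟨fun ⟨hdiv, hmod⟩ => ?_, fun h => h ▸ ⟨rfl, rfl⟩⟩
    rw [← Nat.div_add_mod m b, hdiv, hmod, Nat.div_add_mod]

theorem digits_lt_digits_iff {b k m m' : ℕ} (hb : 0 < b) (hm : m < b ^ k) (hm' : m' < b ^ k) :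
    digits b k m < digits b k m' ↔ m < m' := by
  induction k generalizing m m' with
  | zero => simp_all [digits]
  | succ k ih =>
    have hdiv := div_lt_pow_of_lt_pow_succ hm
    have hdiv' := div_lt_pow_of_lt_pow_succ hm'
    rw [digits_succ, digits_succ, append_lt_append_iff (by simp only [length_digits]),
      ih hdiv hdiv', digits_inj hdiv hdiv', singleton_lt_singleton_iff,
      ← mul_add_lt_mul_add_iff (Nat.mod_lt m hb) (Nat.mod_lt m' hb), Nat.div_add_mod',
      Nat.div_add_mod']

theorem digits_append_digits_inj {b k i j i' j' : ℕ} (hi : i < b ^ k) (hj : j < b ^ k)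
    (hi' : i' < b ^ k) (hj' : j' < b ^ k) :
    digits b k i ++ digits b k j = digits b k i' ++ digits b k j' ↔ i = i' ∧ j = j' := by
  rw [← digits_inj hi hi', ← digits_inj hj hj']
  exact ⟨fun h => List.append_inj h (by simp only [length_digits]), fun h => by rw [h.1, h.2]⟩

theorem exists_digits_eq {b k : ℕ} {w : List ℕ} (hw : w ∈ words b k) :
    ∃ m < b ^ k, digits b k m = w := by
  induction k generalizing w with
  | zero => exact ⟨0, by simp, by rw [List.length_eq_zero_iff.1 hw.1]; rfl⟩
  | succ k ih =>
    obtain ⟨u, hu, v, hv, rfl⟩ := mem_words_add.1 hw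
    obtain ⟨d, hd, rfl⟩ := mem_words_one.1 hv
    obtain ⟨m, hm, rfl⟩ := ih hu
    refine ⟨m * b + d, ?_, ?_⟩
    · calc m * b + d < (m + 1) * b := by rw [add_one_mul]; omega
        _ ≤ b ^ k * b := Nat.mul_le_mul_right b hm
    · rw [digits_succ, Nat.mul_add_mod_of_lt hd, mul_comm m b, Nat.mul_add_div (by omega),
        Nat.div_eq_of_lt hd, add_zero]

/-- `w'` is the successor of `w` in the base-`b` odometer: the last digit that is not `b - 1`
grows by one, and the digits after it, all equal to `b - 1`, are reset to `0`. -/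
inductive IsSuccWord (b : ℕ) : List ℕ → List ℕ → Prop where
  | incr (p : List ℕ) {d : ℕ} (hd : d + 1 < b) : IsSuccWord b (p ++ [d]) (p ++ [d + 1])
  | carry {w w' : List ℕ} (h : IsSuccWord b w w') : IsSuccWord b (w ++ [b - 1]) (w' ++ [0])

theorem isSuccWord_append_singleton_iff {b : ℕ} {w w' : List ℕ} {d d' : ℕ} :
    IsSuccWord b (w ++ [d]) (w' ++ [d']) ↔
      (w' = w ∧ d' = d + 1 ∧ d' < b) ∨ (IsSuccWord b w w' ∧ d = b - 1 ∧ d' = 0) := by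
  constructor
  · generalize hu : w ++ [d] = u, hu' : w' ++ [d'] = u'
    rintro (⟨p, hd⟩ | h) <;> obtain ⟨rfl, rfl⟩ := List.append_singleton_inj.1 hu <;>
      obtain ⟨rfl, rfl⟩ := List.append_singleton_inj.1 hu'
    · exact Or.inl ⟨rfl, rfl, hd⟩
    · exact Or.inr ⟨h, rfl, rfl⟩
  · rintro (⟨rfl, rfl, hd⟩ | ⟨h, rfl, rfl⟩)
    · exact .incr _ hd
    · exact .carry h

theorem not_isSuccWord_nil {b : ℕ} {w : List ℕ} : ¬ IsSuccWord b [] w := by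
  generalize h : [] = u
  rintro (_ | _) <;> simp at h

theorem IsSuccWord.pos {b : ℕ} {w w' : List ℕ} (h : IsSuccWord b w w') : 0 < b := by
  induction h with
  | incr _ hd => exact (Nat.succ_pos _).trans hd
  | carry _ ih => exact ih

theorem mul_add_eq_mul_add_add_one_iff {N p q a c : ℕ} (ha : a < N) (hc : c < N) :
    q * N + c = p * N + a + 1 ↔ (q = p ∧ c = a + 1) ∨ (q = p + 1 ∧ a + 1 = N ∧ c = 0) := by
  have succ_mul_le {p q : ℕ} (h : p < q) : p * N + N ≤ q * N :=
    (add_one_mul p N).symm.trans_le (Nat.mul_le_mul_right N h)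
  refine ⟨fun h => ?_, ?_⟩
  · rcases lt_trichotomy q p with hlt | rfl | hlt
    · have := succ_mul_le hlt
      omega
    · omega
    · obtain hlt' | rfl := (Nat.succ_le_of_lt hlt).lt_or_eq
      · have := succ_mul_le hlt
        have := succ_mul_le hlt'
        grind
      · grind
  · rintro (⟨rfl, rfl⟩ | ⟨rfl, rfl, rfl⟩)
    · omega
    · grind

theorem isSuccWord_digits_iff {b k m m' : ℕ} (hb : 2 ≤ b) (hm : m < b ^ k) (hm' : m' < b ^ k) :
    IsSuccWord b (digits b k m) (digits b k m') ↔ m' = m + 1 := by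
  induction k generalizing m m' with
  | zero => exact iff_of_false not_isSuccWord_nil (by rw [pow_zero] at hm'; omega)
  | succ k ih =>
    have hdiv := div_lt_pow_of_lt_pow_succ hm
    have hdiv' := div_lt_pow_of_lt_pow_succ hm'
    have hmod : m % b < b := Nat.mod_lt m (by omega)
    have hmod' : m' % b < b := Nat.mod_lt m' (by omega)
    rw [digits_succ, digits_succ, isSuccWord_append_singleton_iff, ih hdiv hdiv',
      digits_inj hdiv' hdiv]
    conv_rhs => rw [← Nat.div_add_mod' m b, ← Nat.div_add_mod' m' b,
      mul_add_eq_mul_add_add_one_iff hmod hmod']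
    omega

/-! ### Factored graphs on words -/

namespace DGraph

variable {G H : DGraph (List ℕ)} {b m n : ℕ} {u u' v v' : List ℕ}

theorem cart_verts (hG : G.verts = words b m) (hH : H.verts = words b n) :
    (G.cart H).verts = words b (m + n) := by
  ext w
  rw [mem_words_add, ← hG, ← hH]
  rfl

theorem tensor_verts (hG : G.verts = words b m) (hH : H.verts = words b n) :
    (G.tensor H).verts = words b (m + n) :=
  cart_verts hG hH

theorem cart_edge_append_iff (hG : G.verts = words b n) (hu : u ∈ words b n) (hu' : u' ∈ words b n)
    (hv : v ∈ H.verts) (hv' : v' ∈ H.verts) : (G.cart H).Edge (u ++ v) (u' ++ v') ↔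
      (u = u' ∧ H.Edge v v') ∨ (v = v' ∧ G.Edge u u') := by
  rw [← hG] at hu hu'
  refine ⟨?_, fun h => ⟨u, hu, v, hv, u', hu', v', hv', rfl, rfl, h⟩⟩
  rintro ⟨p, hp, q, -, p', hp', q', -, h, h', hedge⟩
  rw [hG] at hu hu' hp hp'
  obtain ⟨rfl, rfl⟩ := List.append_inj h (hu.1.trans hp.1.symm)
  obtain ⟨rfl, rfl⟩ := List.append_inj h' (hu'.1.trans hp'.1.symm)
  exact hedge

theorem Edge.tensor_append (hG : G.Edge u u') (hH : H.Edge v v') :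
    (G.tensor H).Edge (u ++ v) (u' ++ v') :=
  ⟨u, (G.edge_mem hG).1, v, (H.edge_mem hH).1, u', (G.edge_mem hG).2, v', (H.edge_mem hH).2,
    rfl, rfl, hG, hH⟩

theorem tensor_edge_append_iff (hG : G.verts = words b n) (hu : u ∈ words b n)
    (hu' : u' ∈ words b n) :
    (G.tensor H).Edge (u ++ v) (u' ++ v') ↔ G.Edge u u' ∧ H.Edge v v' := by
  refine ⟨?_, fun h => h.1.tensor_append h.2⟩
  rintro ⟨p, hp, q, -, p', hp', q', -, h, h', hedge⟩
  rw [hG] at hp hp'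
  obtain ⟨rfl, rfl⟩ := List.append_inj h (hu.1.trans hp.1.symm)
  obtain ⟨rfl, rfl⟩ := List.append_inj h' (hu'.1.trans hp'.1.symm)
  exact hedge

end DGraph

theorem InputGraph.toDGraph_verts (A : InputGraph) : A.toDGraph.verts = words A.size 1 := by
  ext w
  rw [mem_words_one]
  exact ⟨fun ⟨i, h⟩ => ⟨i, i.2, h⟩, fun ⟨d, hd, h⟩ => ⟨⟨d, hd⟩, h⟩⟩

theorem InputGraph.toDGraph_edge_iff (A : InputGraph) (i j : ℕ) :
    A.toDGraph.Edge [i] [j] ↔ ∃ (hi : i < A.size) (hj : j < A.size), A.Edge ⟨i, hi⟩ ⟨j, hj⟩ := by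
  constructor
  · rintro ⟨i', j', h, h', hedge⟩
    obtain rfl := List.singleton_inj.1 h
    obtain rfl := List.singleton_inj.1 h'
    exact ⟨i'.2, j'.2, hedge⟩
  · rintro ⟨hi, hj, hedge⟩
    exact ⟨⟨i, hi⟩, ⟨j, hj⟩, rfl, rfl, hedge⟩

theorem InputGraph.reverse_toDGraph_edge_iff (A : InputGraph) (w w' : List ℕ) :
    A.reverse.toDGraph.Edge w w' ↔ A.toDGraph.Edge w' w :=
  ⟨fun ⟨i, j, h, h', hedge⟩ => ⟨j, i, h', h, hedge⟩,
    fun ⟨i, j, h, h', hedge⟩ => ⟨j, i, h', h, hedge⟩⟩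

namespace Formula

theorem unionUpTo_verts {f : ℕ → Formula} {m : ℕ} {S : Set (List ℕ)}
    (h : ∀ i ≤ m, (f i).eval.verts = S) : (unionUpTo f m).eval.verts = S := by
  induction m with
  | zero => exact h 0 le_rfl
  | succ m ih =>
    simp [unionUpTo, eval, DGraph.union, ih fun i hi => h i (by omega), h (m + 1) le_rfl]

theorem unionUpTo_edge_iff (f : ℕ → Formula) (m : ℕ) (w w' : List ℕ) :
    (unionUpTo f m).eval.Edge w w' ↔ ∃ i ≤ m, (f i).eval.Edge w w' := by
  induction m with
  | zero => simp [unionUpTo]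
  | succ m ih => simp [unionUpTo, eval, DGraph.union, ih, Nat.le_succ_iff, or_and_right, exists_or]

theorem cartPrefix_verts {A : InputGraph} (m : ℕ) {n : ℕ} {f : Formula}
    (hf : f.eval.verts = words A.size n) :
    (cartPrefix A m f).eval.verts = words A.size (m + n) := by
  induction m with
  | zero => simpa [cartPrefix] using hf
  | succ m ih =>
    rw [show m + 1 + n = 1 + (m + n) by omega]
    exact DGraph.cart_verts A.toDGraph_verts ih

theorem cartPrefix_edge_iff (b m : ℕ) (f : Formula) (w w' : List ℕ) :
    (cartPrefix (emptyInput b) m f).eval.Edge w w' ↔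
      ∃ p ∈ words b m, ∃ u u', w = p ++ u ∧ w' = p ++ u' ∧ f.eval.Edge u u' := by
  induction m generalizing w w' with
  | zero =>
    refine ⟨fun h => ⟨[], nil_mem_words b, w, w', rfl, rfl, h⟩, ?_⟩
    rintro ⟨p, hp, u, u', rfl, rfl, h⟩
    rwa [List.length_eq_zero_iff.1 hp.1]
  | succ m ih =>
    have empty_verts : (emptyInput b).toDGraph.verts = words b 1 := InputGraph.toDGraph_verts _
    rw [show words b (m + 1) = words b (1 + m) by rw [add_comm]]
    constructor
    · rintro ⟨q, hq, v, -, q', -, v', -, rfl, rfl, ⟨rfl, h⟩ | ⟨-, _, _, -, -, h⟩⟩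
      · obtain ⟨p, hp, u, u', rfl, rfl, hf⟩ := (ih _ _).1 h
        exact ⟨q ++ p, append_mem_words (empty_verts ▸ hq) hp, u, u', by simp, by simp, hf⟩
      · exact h.elim
    · rintro ⟨p, hp, u, u', rfl, rfl, h⟩
      obtain ⟨q, hq, p, hp', rfl⟩ := mem_words_add.1 hp
      have hedge := (ih (p ++ u) (p ++ u')).2 ⟨p, hp', u, u', rfl, rfl, h⟩
      simp only [List.append_assoc]
      exact (DGraph.cart_edge_append_iff empty_verts hq hq (DGraph.edge_mem _ hedge).1
        (DGraph.edge_mem _ hedge).2).2 (Or.inl ⟨rfl, hedge⟩)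

theorem emptyPow_verts (b : ℕ) {k : ℕ} (hk : 1 ≤ k) : (emptyPow b k).eval.verts = words b k := by
  obtain ⟨k, rfl⟩ := Nat.exists_eq_add_of_le' hk
  exact cartPrefix_verts (A := emptyInput b) k (InputGraph.toDGraph_verts _)

theorem not_emptyPow_edge (b k : ℕ) (w w' : List ℕ) : ¬ (emptyPow b k).eval.Edge w w' := by
  rw [emptyPow, cartPrefix_edge_iff]
  rintro ⟨p, -, u, u', -, -, _, _, -, -, h⟩
  exact h

theorem tensorSuffix_verts {B C : InputGraph} (hBC : C.size = B.size) (i : ℕ) :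
    (tensorSuffix C i (.input B)).eval.verts = words B.size (i + 1) := by
  induction i with
  | zero => exact B.toDGraph_verts
  | succ i ih => exact DGraph.tensor_verts ih (hBC ▸ C.toDGraph_verts)

theorem tensorSuffix_edge_of_reverse {B C : InputGraph} {i : ℕ} {w w' : List ℕ}
    (h : (tensorSuffix C.reverse i (.input B.reverse)).eval.Edge w w') :
    (tensorSuffix C i (.input B)).eval.Edge w' w := by
  induction i generalizing w w' with
  | zero => exact (B.reverse_toDGraph_edge_iff w w').1 h
  | succ i ih =>
    obtain ⟨u, -, v, -, u', -, v', -, rfl, rfl, hu, hv⟩ := h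
    exact (ih hu).tensor_append ((C.reverse_toDGraph_edge_iff v v').1 hv)

theorem tensorSuffix_reverse_edge_iff (B C : InputGraph) (i : ℕ) (w w' : List ℕ) :
    (tensorSuffix C.reverse i (.input B.reverse)).eval.Edge w w' ↔
      (tensorSuffix C i (.input B)).eval.Edge w' w :=
  ⟨tensorSuffix_edge_of_reverse,
    fun h => tensorSuffix_edge_of_reverse (B := B.reverse) (C := C.reverse) h⟩

theorem pathOf_verts {b k : ℕ} (hk : 1 ≤ k) {B C : InputGraph} (hB : B.size = b)
    (hC : C.size = b) : (pathOf b k B C).eval.verts = words b k := by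
  subst hB
  refine unionUpTo_verts fun i hi => ?_
  have verts_eq := cartPrefix_verts (A := emptyInput B.size) (k - i - 1) (tensorSuffix_verts hC i)
  rwa [show k - i - 1 + (i + 1) = k by omega] at verts_eq

theorem pathOf_edge_iff {b k : ℕ} (B C : InputGraph) (hk : 1 ≤ k) (w w' : List ℕ) :
    (pathOf b k B C).eval.Edge w w' ↔ ∃ i < k, ∃ p ∈ words b (k - i - 1), ∃ u u',
      w = p ++ u ∧ w' = p ++ u' ∧ (tensorSuffix C i (.input B)).eval.Edge u u' := by
  rw [pathOf, unionUpTo_edge_iff]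
  simp only [cartPrefix_edge_iff, Nat.le_sub_one_iff_lt hk]

theorem pathOf_reverse_edge_iff {b k : ℕ} (B C : InputGraph) (hk : 1 ≤ k) (w w' : List ℕ) :
    (pathOf b k B.reverse C.reverse).eval.Edge w w' ↔ (pathOf b k B C).eval.Edge w' w := by
  simp only [pathOf_edge_iff _ _ hk, tensorSuffix_reverse_edge_iff]
  constructor <;> rintro ⟨i, hi, p, hp, u, u', h, h', hedge⟩ <;>
    exact ⟨i, hi, p, hp, u', u, h', h, hedge⟩

theorem isSuccWord_append_of_tensorSuffix_edge {b i : ℕ} {u u' : List ℕ} (p : List ℕ)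
    (h : (tensorSuffix (wrapInput b) i (.input (succInput b))).eval.Edge u u') :
    IsSuccWord b (p ++ u) (p ++ u') := by
  induction i generalizing u u' with
  | zero =>
    obtain ⟨d, e, rfl, rfl, hde : (e : ℕ) = d + 1⟩ := h
    rw [hde]
    exact .incr p (hde ▸ e.2)
  | succ i ih =>
    obtain ⟨u, -, v, -, u', -, v', -, rfl, rfl, hu, d, e, rfl, rfl, hd, he⟩ := h
    simp only [Nat.eq_sub_of_add_eq hd, he, ← List.append_assoc]
    exact .carry (ih hu)

theorem exists_tensorSuffix_edge_of_isSuccWord {b : ℕ} {w w' : List ℕ}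
    (h : IsSuccWord b w w') : ∃ p i u u', w = p ++ u ∧ w' = p ++ u' ∧
      (tensorSuffix (wrapInput b) i (.input (succInput b))).eval.Edge u u' := by
  induction h with
  | incr p hd =>
    exact ⟨p, 0, _, _, rfl, rfl,
      ((succInput b).toDGraph_edge_iff _ _).2 ⟨(Nat.lt_succ_self _).trans hd, hd, rfl⟩⟩
  | carry h ih =>
    obtain ⟨p, i, u, u', rfl, rfl, hedge⟩ := ih
    have hwrap : (wrapInput b).toDGraph.Edge [b - 1] [0] :=
      ((wrapInput b).toDGraph_edge_iff _ _).2
        ⟨Nat.sub_one_lt h.pos.ne', h.pos, Nat.sub_add_cancel h.pos, rfl⟩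
    exact ⟨p, i + 1, _, _, List.append_assoc .., List.append_assoc .., hedge.tensor_append hwrap⟩

theorem incPath_edge_iff {b k : ℕ} (hk : 1 ≤ k) {w w' : List ℕ} (hw : w ∈ words b k) :
    (incPath b k).eval.Edge w w' ↔ IsSuccWord b w w' := by
  rw [incPath, pathOf_edge_iff _ _ hk]
  constructor
  · rintro ⟨i, -, p, -, u, u', rfl, rfl, hedge⟩
    exact isSuccWord_append_of_tensorSuffix_edge p hedge
  · intro h
    obtain ⟨p, i, u, u', rfl, rfl, hedge⟩ := exists_tensorSuffix_edge_of_isSuccWord h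
    have hu : u ∈ words b (i + 1) :=
      (tensorSuffix_verts (B := succInput b) (C := wrapInput b) rfl i).subset
        (DGraph.edge_mem _ hedge).1
    have hlen : p.length + (i + 1) = k := by rw [← hu.1, ← List.length_append, hw.1]
    exact ⟨i, by omega, p, ⟨by omega, fun d hd => hw.2 d (List.mem_append_left u hd)⟩, u, u',
      rfl, rfl, hedge⟩

theorem incPath_edge_digits_iff {b k : ℕ} (hb : 2 ≤ b) (hk : 1 ≤ k) {m m' : ℕ} (hm : m < b ^ k)
    (hm' : m' < b ^ k) :
    (incPath b k).eval.Edge (digits b k m) (digits b k m') ↔ m' = m + 1 := by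
  rw [incPath_edge_iff hk (digits_mem_words (by omega) k m), isSuccWord_digits_iff hb hm hm']

theorem decPath_edge_iff {b k : ℕ} (hk : 1 ≤ k) (w w' : List ℕ) :
    (decPath b k).eval.Edge w w' ↔ (incPath b k).eval.Edge w' w :=
  pathOf_reverse_edge_iff _ _ hk w w'

theorem incPath_verts (b : ℕ) {k : ℕ} (hk : 1 ≤ k) : (incPath b k).eval.verts = words b k :=
  pathOf_verts hk rfl rfl

theorem grid_verts (b : ℕ) {k : ℕ} (hk : 1 ≤ k) (D : GDir) :
    (grid b k D).eval.verts = words b (k + k) := by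
  have inc_verts := incPath_verts b hk
  have empty_verts := emptyPow_verts b hk
  cases D with
  | V => exact DGraph.cart_verts inc_verts empty_verts
  | H => exact DGraph.cart_verts empty_verts inc_verts
  | R => exact DGraph.tensor_verts inc_verts inc_verts
  | L => exact DGraph.tensor_verts inc_verts (pathOf_verts hk rfl rfl)

theorem grid_edge_digits_iff {b k : ℕ} (hb : 2 ≤ b) (hk : 1 ≤ k) (D : GDir) {i j i' j' : ℕ}
    (hi : i < b ^ k) (hj : j < b ^ k) (hi' : i' < b ^ k) (hj' : j' < b ^ k) :
    (grid b k D).eval.Edge (digits b k i ++ digits b k j) (digits b k i' ++ digits b k j') ↔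
      IsParent D (i, j) (i', j') := by
  have hdigits (m : ℕ) : digits b k m ∈ words b k := digits_mem_words (by omega) k m
  have inc_verts := incPath_verts b hk
  have empty_verts := emptyPow_verts b hk
  cases D with
  | V =>
    rw [grid, eval, DGraph.cart_edge_append_iff inc_verts (hdigits i) (hdigits i')
      (empty_verts ▸ hdigits j) (empty_verts ▸ hdigits j'), incPath_edge_digits_iff hb hk hi hi',
      digits_inj hj hj', or_iff_right fun h => not_emptyPow_edge _ _ _ _ h.2, IsParent, and_comm,
      eq_comm (a := j)]
  | H =>
    rw [grid, eval, DGraph.cart_edge_append_iff empty_verts (hdigits i) (hdigits i')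
      (inc_verts ▸ hdigits j) (inc_verts ▸ hdigits j'), incPath_edge_digits_iff hb hk hj hj',
      digits_inj hi hi', or_iff_left fun h => not_emptyPow_edge _ _ _ _ h.2, IsParent,
      eq_comm (a := i)]
  | R =>
    rw [grid, eval, DGraph.tensor_edge_append_iff inc_verts (hdigits i) (hdigits i'),
      incPath_edge_digits_iff hb hk hi hi', incPath_edge_digits_iff hb hk hj hj', IsParent]
  | L =>
    rw [grid, eval, DGraph.tensor_edge_append_iff inc_verts (hdigits i) (hdigits i'),
      decPath_edge_iff hk, incPath_edge_digits_iff hb hk hi hi',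
      incPath_edge_digits_iff hb hk hj' hj, IsParent, eq_comm (a := j)]

end Formula

/-! ### The factored representation -/

namespace TM.Numbering

variable {α Q Γ : Type} [Fintype Q] [Fintype Γ] {M : TM α Q Γ} (ν : M.Numbering)

section Edges

variable {n : ℕ} (t t' : Tile Q Γ n)

theorem singleton_tileIdx_mem_words : [ν.tileIdx t] ∈ words (ν.tileCount n) 1 :=
  mem_words_one.2 ⟨_, ν.tileIdx_lt t, rfl⟩

theorem completeInput_edge_tileIdx_iff :
    (completeInput (ν.tileCount n)).toDGraph.Edge [ν.tileIdx t] [ν.tileIdx t'] ↔ t ≠ t' := by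
  rw [InputGraph.toDGraph_edge_iff, ← ν.tileIdx_injective.ne_iff]
  exact ⟨fun ⟨_, _, h⟩ => Fin.val_ne_of_ne h,
    fun h => ⟨ν.tileIdx_lt t, ν.tileIdx_lt t', Fin.ne_of_val_ne h⟩⟩

end Edges

variable (x : List α)

theorem relInput_edge_tileIdx_iff (D : GDir) (t t' : Tile Q Γ x.length) :
    (ν.relInput x D).toDGraph.Edge [ν.tileIdx t] [ν.tileIdx t'] ↔ t' ∉ M.cons x D t := by
  rw [InputGraph.toDGraph_edge_iff]
  refine ⟨?_, fun h => ⟨ν.tileIdx_lt t, ν.tileIdx_lt t', t, t', rfl, rfl, h⟩⟩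
  rintro ⟨_, _, s, s', h, h', hcons⟩
  rwa [ν.tileIdx_injective h, ν.tileIdx_injective h'] at hcons

theorem factored_verts (b : ℕ) {k : ℕ} (hk : 1 ≤ k) : (ν.factored x b k).eval.verts =
    {w | ∃ u ∈ words b (k + k), ∃ v ∈ words (ν.tileCount x.length) 1, w = u ++ v} := by
  have empty_verts := Formula.emptyPow_verts b hk
  have complete_verts : (completeInput (ν.tileCount x.length)).toDGraph.verts =
      words (ν.tileCount x.length) 1 := InputGraph.toDGraph_verts _
  have rel_verts (D : GDir) : (ν.relInput x D).toDGraph.verts =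
      words (ν.tileCount x.length) 1 := InputGraph.toDGraph_verts _
  have supernode_verts : (Formula.cart (.cart (.emptyPow b k) (.emptyPow b k))
      (.input (completeInput (ν.tileCount x.length)))).eval.verts =
      {w | ∃ u ∈ words b (k + k), ∃ v ∈ words (ν.tileCount x.length) 1, w = u ++ v} := by
    rw [← DGraph.cart_verts empty_verts empty_verts, ← complete_verts]
    rfl
  have superGrid_verts (D : GDir) : (ν.superGrid x b k D).eval.verts =
      {w | ∃ u ∈ words b (k + k), ∃ v ∈ words (ν.tileCount x.length) 1, w = u ++ v} := by
    rw [← Formula.grid_verts b hk D, ← rel_verts D]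
    rfl
  change _ ∪ (((_ ∪ _) ∪ _) ∪ _) = _
  rw [supernode_verts, superGrid_verts, superGrid_verts, superGrid_verts, superGrid_verts]
  simp only [Set.union_self]

variable {b k i j i' j' : ℕ}

theorem superGrid_edge_iff (hb : 2 ≤ b) (hk : 1 ≤ k) (hi : i < b ^ k) (hj : j < b ^ k)
    (hi' : i' < b ^ k) (hj' : j' < b ^ k) (D : GDir) (t t' : Tile Q Γ x.length) :
    (ν.superGrid x b k D).eval.Edge (digits b k i ++ digits b k j ++ [ν.tileIdx t])
      (digits b k i' ++ digits b k j' ++ [ν.tileIdx t']) ↔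
        IsParent D (i, j) (i', j') ∧ t' ∉ M.cons x D t := by
  have hdigits (m : ℕ) : digits b k m ∈ words b k := digits_mem_words (by omega) k m
  rw [superGrid, Formula.eval, DGraph.tensor_edge_append_iff (Formula.grid_verts b hk D)
    (append_mem_words (hdigits i) (hdigits j)) (append_mem_words (hdigits i') (hdigits j')),
    Formula.grid_edge_digits_iff hb hk D hi hj hi' hj', Formula.eval, relInput_edge_tileIdx_iff]

theorem supernode_edge_iff (hb : 0 < b) (hk : 1 ≤ k) (hi : i < b ^ k) (hj : j < b ^ k)
    (hi' : i' < b ^ k) (hj' : j' < b ^ k) {n : ℕ} (t t' : Tile Q Γ n) :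
    (Formula.cart (.cart (.emptyPow b k) (.emptyPow b k))
      (.input (completeInput (ν.tileCount n)))).eval.Edge
        (digits b k i ++ digits b k j ++ [ν.tileIdx t])
        (digits b k i' ++ digits b k j' ++ [ν.tileIdx t']) ↔ i = i' ∧ j = j' ∧ t ≠ t' := by
  have hdigits (m : ℕ) : digits b k m ∈ words b k := digits_mem_words (by omega) k m
  have empty_verts := Formula.emptyPow_verts b hk
  have not_edge : ¬ (Formula.cart (.emptyPow b k) (.emptyPow b k)).eval.Edge
      (digits b k i ++ digits b k j) (digits b k i' ++ digits b k j') := by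
    rw [Formula.eval, DGraph.cart_edge_append_iff empty_verts (hdigits i) (hdigits i')
      (empty_verts ▸ hdigits j) (empty_verts ▸ hdigits j')]
    simp only [Formula.not_emptyPow_edge, and_false, or_false, not_false_eq_true]
  have complete_verts := (completeInput (ν.tileCount n)).toDGraph_verts
  have base_verts : (Formula.cart (.emptyPow b k) (.emptyPow b k)).eval.verts = words b (k + k) :=
    DGraph.cart_verts empty_verts empty_verts
  rw [Formula.eval, DGraph.cart_edge_append_iff base_verts
    (append_mem_words (hdigits i) (hdigits j)) (append_mem_words (hdigits i') (hdigits j'))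
    (complete_verts ▸ ν.singleton_tileIdx_mem_words t)
    (complete_verts ▸ ν.singleton_tileIdx_mem_words t'), or_iff_left fun h => not_edge h.2,
    digits_append_digits_inj hi hj hi' hj', Formula.eval, completeInput_edge_tileIdx_iff, and_assoc]

theorem factored_edge_iff (hb : 2 ≤ b) (hk : 1 ≤ k) (hi : i < b ^ k) (hj : j < b ^ k)
    (hi' : i' < b ^ k) (hj' : j' < b ^ k) (t t' : Tile Q Γ x.length) :
    (ν.factored x b k).eval.Edge (digits b k i ++ digits b k j ++ [ν.tileIdx t])
      (digits b k i' ++ digits b k j' ++ [ν.tileIdx t']) ↔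
        (i = i' ∧ j = j' ∧ t ≠ t') ∨ ∃ D, IsParent D (i, j) (i', j') ∧ t' ∉ M.cons x D t := by
  change (_ ∨ ((_ ∨ _) ∨ _) ∨ _) ↔ _
  rw [ν.supernode_edge_iff (by omega) hk hi hj hi' hj']
  simp only [ν.superGrid_edge_iff x hb hk hi hj hi' hj']
  refine or_congr_right ⟨?_, ?_⟩
  · rintro (((h | h) | h) | h) <;> exact ⟨_, h⟩
  · rintro ⟨_ | _ | _ | _, h⟩
    · exact Or.inl (Or.inl (Or.inl h))
    · exact Or.inl (Or.inl (Or.inr h))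
    · exact Or.inl (Or.inr h)
    · exact Or.inr h

section Code

variable {n : ℕ}

theorem code_lt_code_iff (hb : 0 < b) (hi : i < b ^ k) (hj : j < b ^ k) (hi' : i' < b ^ k)
    (hj' : j' < b ^ k) (t t' : Tile Q Γ n) :
    ν.code b k ⟨i + 1, j + 1, t⟩ < ν.code b k ⟨i' + 1, j' + 1, t'⟩ ↔
      ν.prec ⟨i + 1, j + 1, t⟩ ⟨i' + 1, j' + 1, t'⟩ := by
  simp only [code, Nat.add_sub_cancel, prec_iff, add_lt_add_iff_right, Nat.add_right_cancel_iff]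
  rw [append_lt_append_iff (by simp only [List.length_append, length_digits]),
    append_lt_append_iff (by simp only [length_digits]), digits_lt_digits_iff hb hi hi',
    digits_inj hi hi', digits_lt_digits_iff hb hj hj', digits_append_digits_inj hi hj hi' hj',
    singleton_lt_singleton_iff]
  grind

theorem bijOn_code (hb : 0 < b) (k n : ℕ) :
    Set.BijOn (ν.code b k) (gridVerts Q Γ n (b ^ k))
      {w | ∃ u ∈ words b (k + k), ∃ v ∈ words (ν.tileCount n) 1, w = u ++ v} := by
  refine ⟨fun v _ => ⟨_, append_mem_words (digits_mem_words hb k _) (digits_mem_words hb k _), _,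
    ν.singleton_tileIdx_mem_words v.tile, rfl⟩, fun v hv v' hv' h => ?_, ?_⟩
  · obtain ⟨i, hi, j, hj, t, rfl⟩ := mem_gridVerts_iff.1 hv
    obtain ⟨i', hi', j', hj', t', rfl⟩ := mem_gridVerts_iff.1 hv'
    obtain ⟨hdigits, htile⟩ := List.append_singleton_inj.1 h
    obtain ⟨rfl, rfl⟩ := (digits_append_digits_inj hi hj hi' hj').1 hdigits
    obtain rfl : t = t' := ν.tileIdx_injective htile
    rfl
  · rintro _ ⟨_, hu, _, hv, rfl⟩
    obtain ⟨_, hw, _, hw', rfl⟩ := mem_words_add.1 hu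
    obtain ⟨i, hi, rfl⟩ := exists_digits_eq hw
    obtain ⟨j, hj, rfl⟩ := exists_digits_eq hw'
    obtain ⟨_, hd, rfl⟩ := mem_words_one.1 hv
    obtain ⟨t, rfl⟩ := ν.exists_tileIdx_eq hd
    exact ⟨⟨i + 1, j + 1, t⟩, mem_gridVerts_iff.2 ⟨i, hi, j, hj, t, rfl⟩, rfl⟩

end Code

theorem gridGraph_isOrderedIso (hb : 2 ≤ b) (hk : 1 ≤ k) :
    (M.gridGraph x (b ^ k)).IsOrderedIso ν.prec (ν.factored x b k).eval (· < ·) (ν.code b k) := by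
  refine ⟨?_, fun u hu v hv => ?_⟩
  · rw [ν.factored_verts x b hk]
    exact ν.bijOn_code (by omega) k x.length
  · obtain ⟨i, hi, j, hj, t, rfl⟩ := mem_gridVerts_iff.1 hu
    obtain ⟨i', hi', j', hj', t', rfl⟩ := mem_gridVerts_iff.1 hv
    exact ⟨(M.gridGraph_edge_iff hi hj hi' hj' t t').trans
      (ν.factored_edge_iff x hb hk hi hj hi' hj' t t').symm,
      (ν.code_lt_code_iff (by omega) hi hj hi' hj' t t').symm⟩

end TM.Numbering

/-! ### Complexity -/

namespace Formula

theorem cartPrefix_ops (A : InputGraph) (m : ℕ) (f : Formula) :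
    (cartPrefix A m f).ops = f.ops + m := by
  induction m with
  | zero => rfl
  | succ m ih => rw [cartPrefix, ops, ops, ih, zero_add, add_assoc]

theorem tensorSuffix_ops (C : InputGraph) (m : ℕ) (f : Formula) :
    (tensorSuffix C m f).ops = f.ops + m := by
  induction m with
  | zero => rfl
  | succ m ih => rw [tensorSuffix, ops, ops, ih, add_zero, add_assoc]

theorem unionUpTo_ops {f : ℕ → Formula} {m r : ℕ} (h : ∀ i ≤ m, (f i).ops = r) :
    (unionUpTo f m).ops = (m + 1) * r + m := by
  induction m with
  | zero => simp [unionUpTo, h 0 le_rfl]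
  | succ m ih =>
    rw [unionUpTo, ops, ih fun i hi => h i (Nat.le_succ_of_le hi), h (m + 1) le_rfl]
    ring

theorem emptyPow_ops (b k : ℕ) : (emptyPow b k).ops = k - 1 := by
  rw [emptyPow, cartPrefix_ops, ops, zero_add]

theorem pathOf_ops (b k : ℕ) (B C : InputGraph) :
    (pathOf b (k + 1) B C).ops = (k + 1) * k + k := by
  refine unionUpTo_ops fun i hi => ?_
  rw [cartPrefix_ops, tensorSuffix_ops, ops]
  omega

section InputsLE

variable {b n : ℕ}

theorem InputsLE.cartPrefix {A : InputGraph} (hA : A.size ≤ n) (m : ℕ) {f : Formula}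
    (hf : f.InputsLE n) : (cartPrefix A m f).InputsLE n := by
  induction m with
  | zero => exact hf
  | succ m ih => exact ⟨hA, ih⟩

theorem InputsLE.tensorSuffix {C : InputGraph} (hC : C.size ≤ n) (m : ℕ) {f : Formula}
    (hf : f.InputsLE n) : (tensorSuffix C m f).InputsLE n := by
  induction m with
  | zero => exact hf
  | succ m ih => exact ⟨ih, hC⟩

theorem InputsLE.unionUpTo {f : ℕ → Formula} (m : ℕ) (h : ∀ i ≤ m, (f i).InputsLE n) :
    (unionUpTo f m).InputsLE n := by
  induction m with
  | zero => exact h 0 le_rfl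
  | succ m ih => exact ⟨ih fun i hi => h i (Nat.le_succ_of_le hi), h _ le_rfl⟩

theorem emptyPow_inputsLE (hb : b ≤ n) (k : ℕ) : (emptyPow b k).InputsLE n :=
  InputsLE.cartPrefix (A := emptyInput b) hb _ (f := .input (emptyInput b)) hb

theorem pathOf_inputsLE (hb : b ≤ n) (k : ℕ) {B C : InputGraph} (hB : B.size ≤ n)
    (hC : C.size ≤ n) : (pathOf b k B C).InputsLE n :=
  InputsLE.unionUpTo _ fun _ _ => InputsLE.cartPrefix (A := emptyInput b) hb _
    (InputsLE.tensorSuffix hC _ (f := .input B) hB)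

theorem grid_inputsLE (hb : b ≤ n) (k : ℕ) (D : GDir) : (grid b k D).InputsLE n := by
  have inc : (incPath b k).InputsLE n := pathOf_inputsLE hb k hb hb
  have dec : (decPath b k).InputsLE n := pathOf_inputsLE hb k hb hb
  have empty : (emptyPow b k).InputsLE n := emptyPow_inputsLE hb k
  cases D
  · exact ⟨inc, empty⟩
  · exact ⟨empty, inc⟩
  · exact ⟨inc, inc⟩
  · exact ⟨inc, dec⟩

end InputsLE

end Formula

theorem TM.Numbering.factored_hasComplexity {α Q Γ : Type} [Fintype Q] [Fintype Γ] {M : TM α Q Γ}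
    (ν : M.Numbering) (x : List α) (b : ℕ) {k : ℕ} (hk : 1 ≤ k) :
    (ν.factored x b k).HasComplexity
      (max b ((Fintype.card Q + 2) * (Fintype.card Γ + x.length))) (6 * k ^ 2 + 4 * k + 5) := by
  constructor
  · have hb := le_max_left b ((Fintype.card Q + 2) * (Fintype.card Γ + x.length))
    have htile := le_max_right b ((Fintype.card Q + 2) * (Fintype.card Γ + x.length))
    have hempty := Formula.emptyPow_inputsLE hb k
    have hgrid (D : GDir) := Formula.grid_inputsLE hb k D
    exact ⟨⟨⟨hempty, hempty⟩, htile⟩,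
      ⟨⟨⟨hgrid _, htile⟩, ⟨hgrid _, htile⟩⟩, ⟨hgrid _, htile⟩⟩, ⟨hgrid _, htile⟩⟩
  · obtain ⟨k, rfl⟩ := Nat.exists_eq_add_of_le' hk
    simp only [factored, superGrid, Formula.ops, Formula.grid, Formula.incPath, Formula.decPath,
      Formula.pathOf_ops, Formula.emptyPow_ops, Nat.add_sub_cancel]
    ring

/-! ### Running time and number of digits -/

theorem exists_le_pow_lt_mul {b m : ℕ} (hb : 2 ≤ b) (hm : 2 ≤ m) :
    ∃ k, 1 ≤ k ∧ m ≤ b ^ k ∧ b ^ k < b * m := by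
  have hk : 0 < Nat.clog b m := Nat.clog_pos hb hm
  refine ⟨Nat.clog b m, hk, Nat.le_pow_clog hb m, ?_⟩
  rw [← Nat.succ_pred_eq_of_pos hk, pow_succ']
  exact Nat.mul_lt_mul_of_pos_left (Nat.pow_pred_clog_lt_self hb hm) (by omega)

theorem exponent_le_of_pow_lt {b n C e k ℓ : ℕ} (hb : 2 ≤ b) (hn : n ≤ b) (hC : C ≤ b ^ e)
    (h : b ^ k < b * (C * n ^ ℓ)) : k ≤ e + ℓ := by
  refine Nat.lt_succ_iff.1 ((Nat.pow_lt_pow_iff_right hb).1 (h.trans_le ?_))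
  calc b * (C * n ^ ℓ) ≤ b * (b ^ e * b ^ ℓ) := by gcongr
    _ = b ^ (e + ℓ + 1) := by ring

theorem six_mul_sq_add_le {k r : ℕ} (hr : 1 ≤ r) (hk : k ≤ r) :
    6 * k ^ 2 + 4 * k + 5 ≤ 15 * r ^ 2 := by
  nlinarith

theorem exists_exponent {C n ℓ : ℕ} (hC : 2 ≤ C) (hn : 1 ≤ n) (hℓ : 1 ≤ ℓ) :
    ∃ k, 1 ≤ k ∧ C * n ^ ℓ ≤ max n 2 ^ k ∧ max n 2 ^ k < max n 2 * (C * n ^ ℓ) ∧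
      6 * k ^ 2 + 4 * k + 5 ≤ 15 * (C + 1) ^ 2 * ℓ ^ 2 ∧
      (C ≤ n → 6 * k ^ 2 + 4 * k + 5 ≤ 60 * ℓ ^ 2) := by
  have hb : 2 ≤ max n 2 := le_max_right n 2
  have hnb : n ≤ max n 2 := le_max_left n 2
  obtain ⟨k, hk, hle, hlt⟩ := exists_le_pow_lt_mul hb
    (hC.trans (Nat.le_mul_of_pos_right C (Nat.pow_pos hn)))
  have ops_le {e : ℕ} (hCe : C ≤ max n 2 ^ e) :
      6 * k ^ 2 + 4 * k + 5 ≤ 15 * ((e + 1) * ℓ) ^ 2 := by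
    refine six_mul_sq_add_le (Nat.mul_pos e.succ_pos hℓ)
      ((exponent_le_of_pow_lt hb hnb hCe hlt).trans ?_)
    rw [add_one_mul]
    exact Nat.add_le_add_right (Nat.le_mul_of_pos_right e hℓ) ℓ
  refine ⟨k, hk, hle, hlt, ?_, fun hCn => ?_⟩
  · exact (ops_le (Nat.lt_pow_self hb).le).trans_eq (by ring)
  · exact (ops_le ((pow_one (max n 2)).symm ▸ hCn.trans hnb)).trans_eq (by ring)

theorem max_tileCount_le {n : ℕ} (hn : 1 ≤ n) (q g : ℕ) :
    max (max n 2) ((q + 2) * (g + n)) ≤ ((q + 2) * (g + 1) + 2) * n := by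
  have hgn : g + n ≤ (g + 1) * n := by
    rw [add_one_mul]
    exact Nat.add_le_add_right (Nat.le_mul_of_pos_right g hn) n
  have htile : (q + 2) * (g + n) ≤ (q + 2) * (g + 1) * n :=
    (Nat.mul_le_mul_left (q + 2) hgn).trans_eq (mul_assoc _ _ _).symm
  rw [add_mul _ 2 n]
  omega

namespace TM

variable {α Q Γ : Type} {M : TM α Q Γ}

theorem DecidesInTimePow.exists_time_le {L : Language α} {ℓ : ℕ}
    (h : M.DecidesInTimePow L ℓ) : ∃ C, 2 ≤ C ∧ ∀ x : List α, x ≠ [] →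
      ∃ s, s + 1 ≤ C * x.length ^ ℓ ∧ M.HaltsAfter x s := by
  obtain ⟨-, f, hf, hO⟩ := h
  obtain ⟨c, -, hc⟩ := bound_of_isBigO_nat_atTop hO
  obtain ⟨C, hC⟩ := exists_nat_ge c
  refine ⟨C + 2, Nat.le_add_left 2 C, fun x hx => ?_⟩
  obtain ⟨s, hs, hhalts⟩ := hf x
  have hpos : 0 < x.length ^ ℓ := Nat.pow_pos (List.length_pos_iff.2 hx)
  have hfx : f x.length ≤ C * x.length ^ ℓ := by
    have hcx := hc (x := x.length) (by exact_mod_cast hpos.ne')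
    rw [Real.norm_natCast, ← Nat.cast_pow, Real.norm_natCast] at hcx
    exact_mod_cast hcx.trans (mul_le_mul_of_nonneg_right hC (Nat.cast_nonneg _))
  exact ⟨s, by rw [add_mul]; omega, hhalts⟩

theorem acceptNode_mem_gridVerts (M : TM α Q Γ) (n : ℕ) {T : ℕ} (hT : 1 ≤ T) :
    M.acceptNode n T ∈ gridVerts Q Γ n T :=
  ⟨hT, le_rfl, le_rfl, hT⟩

theorem Numbering.code_acceptNode_mem_verts [Fintype Q] [Fintype Γ] (ν : M.Numbering) (x : List α)
    {b k : ℕ} (hb : 2 ≤ b) (hk : 1 ≤ k) :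
    ν.code b k (M.acceptNode x.length (b ^ k)) ∈ (ν.factored x b k).eval.verts :=
  (ν.gridGraph_isOrderedIso x hb hk).1.mapsTo
    (M.acceptNode_mem_gridVerts _ (Nat.pow_pos (by omega)))

theorem Numbering.code_acceptNode_mem_lfmis_iff [Fintype Q] [Fintype Γ] (ν : M.Numbering)
    (hM : M.Normalized) {x : List α} (hx : x ≠ []) {b k s : ℕ} (hb : 2 ≤ b) (hk : 1 ≤ k)
    (hs : s + 1 ≤ b ^ k) (hh : M.HaltsAfter x s) :
    ν.code b k (M.acceptNode x.length (b ^ k)) ∈ (ν.factored x b k).eval.lfmis (· < ·) ↔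
      M.Accepts x :=
  ((ν.gridGraph_isOrderedIso x hb hk).mem_lfmis_iff
    (M.acceptNode_mem_gridVerts _ (Nat.pow_pos (by omega)))).trans
    (accepts_iff_acceptNode_mem_lfmis ν hM hx hs hh).symm

end TM

/-! ### Normalization of Turing machines -/

/-- The states of the normalized machine: the start state, the states of the simulated machine, and,
for either answer, the return to the leftmost cell, the last move and the halting state. -/
inductive NormState (Q : Type) where
  | start : NormState Q
  | sim (q : Q) : NormState Q
  | ret (r : Bool) : NormState Q
  | fin (r : Bool) : NormState Q
  | halt (r : Bool) : NormState Q
deriving Fintype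

namespace TM

variable {α Q Γ : Type} (M : TM α Q Γ)

open Classical in
/-- The state of the normalized machine after the simulated machine has entered `q`. -/
noncomputable def normNext (q : Q) : NormState Q :=
  if M.Halting q then .ret (decide (q = M.qacc)) else .sim q

open Classical in
/-- A machine that marks the leftmost cell in its first step, simulates `M`, and before halting
returns to the leftmost cell and erases it. The Boolean next to a tape symbol is the mark. -/
noncomputable def normalize : TM α (NormState Q) (Γ × Bool) where
  δ
    | .start, (a, _) =>
      if M.Halting M.q₀ then (.fin (decide (M.q₀ = M.qacc)), (M.blank, false), .R)
      else (M.normNext (M.δ M.q₀ a).1, ((M.δ M.q₀ a).2.1, true), (M.δ M.q₀ a).2.2)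
    | .sim q, (a, m) => (M.normNext (M.δ q a).1, ((M.δ q a).2.1, m), (M.δ q a).2.2)
    | .ret r, (a, m) => if m then (.fin r, (M.blank, false), .R) else (.ret r, (a, m), .L)
    | .fin r, s => (.halt r, s, .L)
    | .halt r, s => (.halt r, s, .L)
  q₀ := .start
  qacc := .halt true
  qrej := .halt false
  qacc_ne_qrej := by simp
  blank := (M.blank, false)
  inp := ⟨fun a => (M.inp a, false), fun a b h => M.inp.injective (Prod.ext_iff.1 h).1⟩
  inp_ne_blank a h := M.inp_ne_blank a (Prod.ext_iff.1 h).1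

/-- The configuration of the normalized machine that corresponds to a configuration of `M` after
at least one step. -/
noncomputable def normCfg (c : Cfg Q Γ) : Cfg (NormState Q) (Γ × Bool) where
  state := M.normNext c.state
  head := c.head
  tape j := (c.tape j, decide (j = 0))

variable {M} {x : List α} {c c' : Cfg Q Γ}

theorem normalize_halting_iff (p : NormState Q) : M.normalize.Halting p ↔ ∃ r, p = .halt r := by
  constructor
  · rintro (rfl | rfl) <;> exact ⟨_, rfl⟩
  · rintro ⟨_ | _, rfl⟩
    · exact Or.inr rfl
    · exact Or.inl rfl

theorem normalize_init_tape (j : ℕ) : (M.normalize.init x).tape j = ((M.init x).tape j, false) := by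
  simp only [init]
  cases x[j]? <;> rfl

theorem not_halting_normalize_init : ¬ M.normalize.Halting (M.normalize.init x).state := by
  rw [normalize_halting_iff]
  rintro ⟨_, h⟩
  cases h

theorem normalize_step_init (h : M.step (M.init x) = some c) :
    M.normalize.step (M.normalize.init x) = some (M.normCfg c) := by
  obtain ⟨hh, hstate, htape, hmove⟩ := step_eq_some_iff.1 h
  have hδ : M.normalize.δ (M.normalize.init x).state ((M.normalize.init x).tape 0) =
      (M.normNext c.state, (c.tape 0, true), (M.δ M.q₀ ((M.init x).tape 0)).2.2) := by
    rw [normalize_init_tape, hstate, htape]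
    exact (if_neg hh).trans (by simp [init])
  have htape' : Function.update (M.normalize.init x).tape 0 (c.tape 0, true) =
      (M.normCfg c).tape := by
    funext j
    rcases eq_or_ne j 0 with rfl | hj
    · exact Function.update_self ..
    · rw [Function.update_of_ne hj, normalize_init_tape]
      simp [normCfg, htape, Function.update_of_ne (show j ≠ (M.init x).head from hj), hj]
  exact (step_eq_some_of_δ_eq not_halting_normalize_init hδ hmove).trans
    (congrArg (fun t => some (Cfg.mk (M.normNext c.state) c.head t)) htape')

theorem normalize_step_normCfg (h : M.step c = some c') :
    M.normalize.step (M.normCfg c) = some (M.normCfg c') := by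
  obtain ⟨hh, hstate, htape, hmove⟩ := step_eq_some_iff.1 h
  have hsim : (M.normCfg c).state = .sim c.state := if_neg hh
  rw [step_eq_some_iff, hsim]
  refine ⟨by simp [normalize_halting_iff], congrArg M.normNext hstate, ?_, hmove⟩
  funext j
  rcases eq_or_ne j c.head with rfl | hj
  · simp [normCfg, normalize, htape]
  · simp [normCfg, htape, hj]

theorem normalize_run_succ {s : ℕ} (h : M.run x (s + 1) = some c) :
    M.normalize.run x (s + 1) = some (M.normCfg c) := by
  induction s generalizing c with
  | zero => exact normalize_step_init h
  | succ s ih =>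
    obtain ⟨d, hd, h⟩ := run_succ_eq_some_iff.1 h
    exact run_succ_eq_some_iff.2 ⟨_, ih hd, normalize_step_normCfg h⟩

theorem normalize_step_fin (r : Bool) (t : ℕ → Γ × Bool) :
    M.normalize.step ⟨.fin r, 1, t⟩ = some ⟨.halt r, 0, t⟩ :=
  step_eq_some_iff.2
    ⟨by simp [normalize_halting_iff], rfl, (Function.update_eq_self 1 t).symm, rfl⟩

theorem normalize_step_ret_zero (r : Bool) {t : ℕ → Γ × Bool} (ht : (t 0).2 = true) :
    M.normalize.step ⟨.ret r, 0, t⟩ =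
      some ⟨.fin r, 1, Function.update t 0 M.normalize.blank⟩ :=
  step_eq_some_of_δ_eq (by simp [normalize_halting_iff]) (if_pos ht) rfl

theorem normalize_step_ret_succ (r : Bool) {t : ℕ → Γ × Bool} {j : ℕ}
    (ht : (t (j + 1)).2 = false) :
    M.normalize.step ⟨.ret r, j + 1, t⟩ = some ⟨.ret r, j, t⟩ := by
  have hδ : M.normalize.δ (.ret r) (t (j + 1)) = (.ret r, t (j + 1), .L) :=
    if_neg (Bool.eq_false_iff.1 ht)
  simp [step_eq_some_iff, normalize_halting_iff, hδ, Dir.IsMove]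

theorem normalize_run_ret {s j : ℕ} {r : Bool} {t : ℕ → Γ × Bool}
    (ht : ∀ i, (t i).2 = decide (i = 0)) (hs : M.normalize.run x s = some ⟨.ret r, j, t⟩) :
    M.normalize.run x (s + j + 2) =
      some ⟨.halt r, 0, Function.update t 0 M.normalize.blank⟩ := by
  induction j generalizing s with
  | zero =>
    have hfin := run_succ_eq_some_iff.2 ⟨_, hs, normalize_step_ret_zero r (ht 0)⟩
    exact run_succ_eq_some_iff.2 ⟨_, hfin, normalize_step_fin r _⟩
  | succ j ih =>
    rw [← add_assoc, add_right_comm s j 1]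
    exact ih (run_succ_eq_some_iff.2 ⟨_, hs, normalize_step_ret_succ r (ht (j + 1))⟩)

open Classical in
theorem normalize_run_two (h : M.Halting M.q₀) : M.normalize.run x 2 =
    some ⟨.halt (decide (M.q₀ = M.qacc)), 0,
      Function.update (M.normalize.init x).tape 0 M.normalize.blank⟩ := by
  have hfin : M.normalize.step (M.normalize.init x) =
      some ⟨.fin (decide (M.q₀ = M.qacc)), 1,
        Function.update (M.normalize.init x).tape 0 M.normalize.blank⟩ :=
    step_eq_some_of_δ_eq not_halting_normalize_init (if_pos h) rfl
  exact run_succ_eq_some_iff.2 ⟨_, run_succ_eq_some_iff.2 ⟨_, rfl, hfin⟩, normalize_step_fin _ _⟩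

open Classical in
theorem exists_normalize_run {s : ℕ} (hc : M.run x s = some c) (hh : M.Halting c.state) :
    ∃ s' ≤ 2 * s + 2, ∃ t, t 0 = M.normalize.blank ∧
      M.normalize.run x s' = some ⟨.halt (decide (c.state = M.qacc)), 0, t⟩ := by
  cases s with
  | zero =>
    obtain rfl : M.init x = c := Option.some.inj hc
    exact ⟨2, le_rfl, _, Function.update_self .., normalize_run_two hh⟩
  | succ s =>
    have hret : M.normCfg c = ⟨.ret (decide (c.state = M.qacc)), c.head,
        fun j => (c.tape j, decide (j = 0))⟩ := by
      simp [normCfg, normNext, hh]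
    have hle : c.head ≤ s + 1 := head_le_of_run hc
    exact ⟨s + 1 + c.head + 2, by omega, _, Function.update_self ..,
      normalize_run_ret (fun _ => rfl) (hret ▸ normalize_run_succ hc)⟩

theorem normalize_normalized (h : ∀ x, ∃ s, M.HaltsAfter x s) : M.normalize.Normalized := by
  intro x s c hc hh
  obtain ⟨_, _, hc', hh'⟩ := h x
  obtain ⟨_, _, t, ht, hrun⟩ := exists_normalize_run hc' hh'
  rw [halting_unique hc hh hrun ((normalize_halting_iff _).2 ⟨_, rfl⟩)]
  exact ⟨rfl, ht⟩

theorem HaltsAfter.normalize {s : ℕ} (h : M.HaltsAfter x s) :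
    ∃ s' ≤ 2 * s + 2, M.normalize.HaltsAfter x s' := by
  obtain ⟨c, hc, hh⟩ := h
  obtain ⟨s', hs', t, -, hrun⟩ := exists_normalize_run hc hh
  exact ⟨s', hs', _, hrun, (normalize_halting_iff _).2 ⟨_, rfl⟩⟩

theorem HaltsAfter.normalize_accepts_iff {s : ℕ} (h : M.HaltsAfter x s) :
    M.normalize.Accepts x ↔ M.Accepts x := by
  obtain ⟨c, hc, hh⟩ := h
  obtain ⟨s', -, t, -, hrun⟩ := exists_normalize_run hc hh
  rw [accepts_iff_of_halting hc hh,
    accepts_iff_of_halting hrun ((normalize_halting_iff _).2 ⟨_, rfl⟩)]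
  simp [TM.normalize]

end TM

theorem isBigO_const_pow_atTop (a : ℝ) (ℓ : ℕ) :
    (fun _ : ℕ => a) =O[atTop] fun n : ℕ => (n : ℝ) ^ ℓ := by
  refine (isBigO_const_const a (one_ne_zero (α := ℝ)) atTop).trans (IsBigO.of_norm_eventuallyLE ?_)
  filter_upwards [eventually_ge_atTop 1] with n hn
  rw [norm_one]
  exact one_le_pow₀ (Nat.one_le_cast.2 hn)

theorem TM.DecidesInTimePow.exists_haltsAfter {α Q Γ : Type} {M : TM α Q Γ} {L : Language α}
    {ℓ : ℕ} (h : M.DecidesInTimePow L ℓ) (x : List α) : ∃ s, M.HaltsAfter x s := by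
  obtain ⟨-, f, hf, -⟩ := h
  obtain ⟨s, -, hs⟩ := hf x
  exact ⟨s, hs⟩

theorem TM.DecidesInTimePow.normalize {α Q Γ : Type} {M : TM α Q Γ} {L : Language α} {ℓ : ℕ}
    (h : M.DecidesInTimePow L ℓ) : M.normalize.DecidesInTimePow L ℓ := by
  obtain ⟨hL, f, hf, hO⟩ := h
  refine ⟨fun x => ?_, fun n => 2 * f n + 2, fun x => ?_, ?_⟩
  · obtain ⟨s, -, hs⟩ := hf x
    rw [hL x, hs.normalize_accepts_iff]
  · obtain ⟨s, hs, hhalts⟩ := hf x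
    obtain ⟨s', hs', hhalts'⟩ := hhalts.normalize
    exact ⟨s', hs'.trans (by dsimp only; omega), hhalts'⟩
  · push_cast
    exact (hO.const_mul_left 2).add (isBigO_const_pow_atTop 2 ℓ)

end FactoredLFMIS

theorem mainTheorem6 :
    -- the grid graph simulates the machine
    (∀ (α Q Γ : Type) [Fintype Q] [Fintype Γ] (M : FactoredLFMIS.TM α Q Γ) (ν : M.Numbering)
        (x : List α) (T : ℕ),
      M.Normalized → x ≠ [] → (∃ s, s + 1 ≤ T ∧ M.HaltsAfter x s) →
      (M.Accepts x ↔ M.acceptNode x.length T ∈ (M.gridGraph x T).lfmis ν.prec)) ∧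
    -- the factored representation of the grid graph
    (∀ (α Q Γ : Type) [Fintype Q] [Fintype Γ] (M : FactoredLFMIS.TM α Q Γ) (ν : M.Numbering)
        (x : List α) (b k : ℕ), 2 ≤ b → 1 ≤ k →
      (M.gridGraph x (b ^ k)).IsOrderedIso ν.prec (ν.factored x b k).eval (· < ·) (ν.code b k) ∧
      (ν.factored x b k).HasComplexity
        (max b ((Fintype.card Q + 2) * (Fintype.card Γ + x.length))) (6 * k ^ 2 + 4 * k + 5)) ∧
    -- the efficient reduction from a language in `DTIME(n ^ ℓ)`
    (∃ c : ℕ, ∀ (α Q Γ : Type) [Fintype Q] [Fintype Γ] (M : FactoredLFMIS.TM α Q Γ)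
        (ν : M.Numbering), M.Normalized → ∃ c₁ : ℕ, ∀ (L : Language α) (ℓ : ℕ),
      1 ≤ ℓ → M.DecidesInTimePow L ℓ →
      ∃ C c₂ N : ℕ, ∀ x : List α, x ≠ [] →
        ∃ k : ℕ, 1 ≤ k ∧
          C * x.length ^ ℓ ≤ max x.length 2 ^ k ∧
          max x.length 2 ^ k < max x.length 2 * (C * x.length ^ ℓ) ∧
          (∃ s, s + 1 ≤ C * x.length ^ ℓ ∧ M.HaltsAfter x s) ∧
          (∃ n' k' : ℕ, (ν.factored x (max x.length 2) k).HasComplexity n' k' ∧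
            n' ≤ c₁ * x.length ∧ k' ≤ c₂ * ℓ ^ 2 ∧ (N ≤ x.length → k' ≤ c * ℓ ^ 2)) ∧
          ν.code (max x.length 2) k (M.acceptNode x.length (max x.length 2 ^ k)) ∈
            (ν.factored x (max x.length 2) k).eval.verts ∧
          (ν.code (max x.length 2) k (M.acceptNode x.length (max x.length 2 ^ k)) ∈
            (ν.factored x (max x.length 2) k).eval.lfmis (· < ·) ↔ M.Accepts x) ∧
          (M.Accepts x ↔ x ∈ L)) ∧
    -- the normal form of the machine is no restriction on the language
    (∀ (α Q Γ : Type) [Fintype Q] [Fintype Γ] (M : FactoredLFMIS.TM α Q Γ) (L : Language α)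
        (ℓ : ℕ), 1 ≤ ℓ → M.DecidesInTimePow L ℓ →
      ∃ (Q' Γ' : Type) (_ : Fintype Q') (_ : Fintype Γ') (M' : FactoredLFMIS.TM α Q' Γ'),
        M'.Normalized ∧ M'.DecidesInTimePow L ℓ) := by
  refine ⟨?_, ?_, ?_, ?_⟩
  · intro α Q Γ _ _ M ν x T hM hx ⟨s, hs, hhalts⟩
    exact FactoredLFMIS.TM.accepts_iff_acceptNode_mem_lfmis ν hM hx hs hhalts
  · intro α Q Γ _ _ M ν x b k hb hk
    exact ⟨ν.gridGraph_isOrderedIso x hb hk, ν.factored_hasComplexity x b hk⟩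
  · refine ⟨60, fun α Q Γ _ _ M ν hM =>
      ⟨(Fintype.card Q + 2) * (Fintype.card Γ + 1) + 2, fun L ℓ hℓ hL => ?_⟩⟩
    obtain ⟨C, hC, htime⟩ := hL.exists_time_le
    refine ⟨C, 15 * (C + 1) ^ 2, C, fun x hx => ?_⟩
    obtain ⟨s, hs, hhalts⟩ := htime x hx
    have hn : 1 ≤ x.length := List.length_pos_iff.2 hx
    have hb : 2 ≤ max x.length 2 := le_max_right _ _
    obtain ⟨k, hk, hle, hlt, hops, hops_large⟩ := FactoredLFMIS.exists_exponent hC hn hℓ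
    exact ⟨k, hk, hle, hlt, ⟨s, hs, hhalts⟩,
      ⟨_, _, ν.factored_hasComplexity x _ hk, FactoredLFMIS.max_tileCount_le hn _ _, hops,
        hops_large⟩,
      ν.code_acceptNode_mem_verts x hb hk,
      ν.code_acceptNode_mem_lfmis_iff hM hx hb hk (hs.trans hle) hhalts, (hL.1 x).symm⟩
  · intro α Q Γ _ _ M L ℓ _ hL
    exact ⟨_, _, inferInstance, inferInstance, M.normalize,
      FactoredLFMIS.TM.normalize_normalized hL.exists_haltsAfter, hL.normalize⟩
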